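/- For every $d\ge 1$ let $p_d$ be a monic real polynomial of degree $d$ with only real roots $\lambda_1(p_d),\dots,\lambda_d(p_d)$ (with multiplicity), and put $m_n(p_d)=\frac1d\sum_{i=1}^d\lambda_i(p_d)^n$. Write $p_d(x)=\sum_{k=0}^d x^{d-k}(-1)^k\binom dk a_k(p_d)$. The finite free cumulants of $p_d$ are, for $1\le n\le d$, $$\kappa_n(p_d)=\frac{(-d)^{n-1}}{(n-1)!}\sum_{\pi\in P(n)}(-1)^{|\pi|-1}(|\pi|-1)!\prod_{V\in\pi}a_{|V|}(p_d),$$ where $P(n)$ is the set of all set partitions of $[n]=\{1,\dots,n\}$ and $|\pi|$ is the number of blocks of $\pi$. Let $\mu$ be a probability measure on $\mathbb R$ with finite moments $m_n(\mu)$ of all orders, and let its free cumulants $(r_n(\mu))_{n\ge1}$ be defined recursively by $m_n(\mu)=\sum_{\pi\in NC(n)}\prod_{V\in\pi}r_{|V|}(\mu)$ for $n\ge1$, where $NC(n)$ is the set of non-crossing partitions of $[n]$. For $V\in\pi$ put $r_{\pi\setminus V}(\mu)=\prod_{W\in\pi,\,W\ne V}r_{|W|}(\mu)$. For $t,s\ge1$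 let $\gamma_{t,s}=(1,\dots,t)(t+1,\dots,t+s)\in S_{t+s}$ and let $S_{NC}(t,s)$ be the set of $\sigma\in S_{t+s}$ such that $\langle\sigma,\gamma_{t,s}\rangle$ acts transitively on $[t+s]$ and $|\sigma|+|\sigma^{-1}\gamma_{t,s}|=t+s$, where $|\cdot|$ is the number of cycles of a permutation (fixed points included). Put $r_\sigma(\mu)=\prod_{c}r_{|c|}(\mu)$, the product over all cycles $c$ of $\sigma$, where $|c|$ is the length of $c$. **Lemma.** Suppose that $\mathfrak p=(p_d)_{d\ge1}$ has limiting distribution $\mu$, that is, $m_n(p_d)\to m_n(\mu)$ as $d\to\infty$ for every $n\ge0$. Then the following are equivalent (all $o(1/d)$ are for $d\to\infty$ with $n$ fixed): 1. $\mathfrak p$ has infinitesimal moments of all orders: there is a real sequence $(m'_n)_{n\ge1}$, not depending on $d$, with $m_n(p_d)=m_n(\mu)+\frac1d m'_n+o(1/d)$ for every $n\ge1$. 2. There is a real sequence $(\widehat r_n)_{n\ge1}$, not depending on $d$, with $\kappa_n(p_d)=r_n(\mu)+\frac1d\widehat r_n+o(1/d)$ for every $n\ge1$ (where $d\ge n$).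 Moreover, the sequences in (1) and (2) determine each other through the relation $$m'_n=\sum_{\pi\in NC(n)}\sum_{V\in\pi}\widehat r_{|V|}\,r_{\pi\setminus V}(\mu)-\frac n2\sum_{\substack{t+s=n\\ t,s\ge1}}\ \sum_{\sigma\in S_{NC}(t,s)}\frac{r_\sigma(\mu)}{ts}\qquad\text{for all }n\ge1.\tag{$*$}$$ That is: if $(m'_n)$ is as in (1) and $(\widehat r_n)$ is as in (2), then $(*)$ holds; and if two real sequences $(m'_n)_{n\ge1}$, $(\widehat r_n)_{n\ge1}$ satisfy $(*)$, then $(m'_n)$ satisfies (1) if and only if $(\widehat r_n)$ satisfies (2). -/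

import Mathlib

open Filter Topology Asymptotics MeasureTheory

namespace FiniteFree

noncomputable section

/-! ### Set partitions and annular permutations -/

/-- Set partitions of an `n`-element linearly ordered set, `P(n)`. -/
abbrev SetPartition (n : ℕ) : Type := Finpartition (Finset.univ : Finset (Fin n))

/-- A set partition is non-crossing if `a < b < c < e` with `a, c` in one block and
`b, e` in one block forces the two blocks to coincide. -/
def IsNonCrossing {n : ℕ} (π : SetPartition n) : Prop :=
  ∀ V ∈ π.parts, ∀ W ∈ π.parts, ∀ a b c e : Fin n, a < b → b < c → c < e →
    a ∈ V → c ∈ V → b ∈ W → e ∈ W → V = W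

open Classical in
/-- The finite set `NC(n)` of non-crossing partitions. -/
def NC (n : ℕ) : Finset (SetPartition n) :=
  Finset.univ.filter IsNonCrossing

/-- `γ_{t,s} = (1, 2, …, t)(t + 1, …, t + s)`, as a permutation of `Fin (t + s)`: the cyclic
rotation on the first `t` and on the last `s` points. -/
def annularRotation (t s : ℕ) : Equiv.Perm (Fin (t + s)) :=
  finSumFinEquiv.permCongr (Equiv.Perm.sumCongr (finRotate t) (finRotate s))

/-- The number of cycles of a permutation, fixed points included. -/
def numCycles {n : ℕ} (σ : Equiv.Perm (Fin n)) : ℕ := σ.partition.parts.card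

/-- The annular non-crossing permutations: `⟨σ, γ_{t,s}⟩` acts transitively and
`|σ| + |σ⁻¹ γ_{t,s}| = t + s`, where `|·|` counts cycles. -/
def IsAnnularNonCrossing (t s : ℕ) (σ : Equiv.Perm (Fin (t + s))) : Prop :=
  MulAction.IsPretransitive (Subgroup.closure {σ, annularRotation t s}) (Fin (t + s)) ∧
    numCycles σ + numCycles (σ⁻¹ * annularRotation t s) = t + s

open Classical in
/-- The finite set `S_NC(t, s)`. -/
def annularNC (t s : ℕ) : Finset (Equiv.Perm (Fin (t + s))) :=
  Finset.univ.filter (IsAnnularNonCrossing t s)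

/-- `u_π = ∏_{V ∈ π} u_{|V|}`. -/
def blockProd (u : ℕ → ℝ) {n : ℕ} (π : SetPartition n) : ℝ :=
  ∏ V ∈ π.parts, u V.card

/-- `u_σ = ∏_{c ∈ σ} u_{|c|}`, the product over all cycles (fixed points included). -/
def cycleProd (u : ℕ → ℝ) {n : ℕ} (σ : Equiv.Perm (Fin n)) : ℝ :=
  (σ.partition.parts.map u).prod

/-! ### Free cumulants -/

/-- The free cumulants of a moment sequence `m`, by the recursion
`r_n = m_n - ∑_{π ∈ NC(n), π ≠ 1_n} ∏_{V ∈ π} r_{|V|}`. Every block of a partition `π ≠ 1_n` has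
fewer than `n` elements (`card_lt_of_ne_top`), so the value `0` below is never used; see
`moment_eq_sum_blockProd` for the resulting moment-cumulant formula. -/
def freeCumulantSeq (m : ℕ → ℝ) (n : ℕ) : ℝ :=
  m n - ∑ π ∈ (NC n).erase ⊤, ∏ V ∈ π.parts,
    if _h : V.card < n then freeCumulantSeq m V.card else 0
termination_by n

theorem card_lt_of_ne_top {n : ℕ} {π : SetPartition n} (hπ : π ≠ ⊤) {V : Finset (Fin n)}
    (hV : V ∈ π.parts) : V.card < n := by
  rcases lt_or_eq_of_le (by simpa using Finset.card_le_univ V) with h | h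
  · exact h
  · exfalso
    have hVu : V = Finset.univ := (Finset.card_eq_iff_eq_univ V).1 (by simpa using h)
    apply hπ
    refine le_antisymm le_top fun b hb => ⟨V, hV, ?_⟩
    rw [hVu]
    exact Finset.subset_univ b

theorem top_mem_NC {n : ℕ} : (⊤ : SetPartition n) ∈ NC n := by
  classical
  simp only [NC, Finset.mem_filter, Finset.mem_univ, true_and]
  intro V hV W hW _ _ _ _ _ _ _ _ _ _ _
  exact Finpartition.parts_top_subsingleton _ hV hW

/-- The moment-cumulant formula, which determines the free cumulants. -/
theorem moment_eq_sum_blockProd (m : ℕ → ℝ) {n : ℕ} (hn : 1 ≤ n) :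
    m n = ∑ π ∈ NC n, blockProd (freeCumulantSeq m) π := by
  classical
  have hne : (Finset.univ : Finset (Fin n)) ≠ ⊥ := by
    have : Nonempty (Fin n) := ⟨⟨0, hn⟩⟩
    exact Finset.univ_nonempty.ne_empty
  have htop : blockProd (freeCumulantSeq m) (⊤ : SetPartition n) = freeCumulantSeq m n := by
    have : (⊤ : SetPartition n).parts = {Finset.univ} := by
      apply (Finset.Nonempty.subset_singleton_iff
        (Finpartition.parts_nonempty _ hne)).1 (Finpartition.parts_top_subset _)
    simp [blockProd, this]
  rw [← Finset.add_sum_erase _ _ top_mem_NC, htop, freeCumulantSeq]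
  have : ∀ π ∈ (NC n).erase ⊤, (∏ V ∈ π.parts,
      if _h : V.card < n then freeCumulantSeq m V.card else 0)
      = blockProd (freeCumulantSeq m) π := by
    intro π hπ
    refine Finset.prod_congr rfl fun V hV => ?_
    rw [dif_pos (card_lt_of_ne_top (Finset.ne_of_mem_erase hπ) hV)]
  rw [Finset.sum_congr rfl this]
  ring

/-- The moment `m_n(μ) = ∫ xⁿ dμ`. -/
def moment (μ : Measure ℝ) (n : ℕ) : ℝ := ∫ x, x ^ n ∂μ

/-- The free cumulant `r_n(μ)`. -/
def freeCumulant (μ : Measure ℝ) (n : ℕ) : ℝ := freeCumulantSeq (moment μ) n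

/-! ### Polynomials -/

/-- Monic real polynomials of degree `d` all of whose roots are real. -/
def IsMonicRealRooted (d : ℕ) (p : Polynomial ℝ) : Prop :=
  p.Monic ∧ p.natDegree = d ∧ p.Splits

/-- The `n`-th moment of the root distribution, `(1/d) ∑ λ_iⁿ` over the roots counted with
multiplicity. -/
def rootMoment (p : Polynomial ℝ) (n : ℕ) : ℝ :=
  (1 / (p.natDegree : ℝ)) * (p.roots.map fun x => x ^ n).sum

/-- The normalized coefficients `a_k`, given for `0 ≤ k ≤ d = deg p` by
`p = ∑_{k ≤ d} x^{d-k} (-1)^k (d choose k) a_k`. -/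
def normCoeff (p : Polynomial ℝ) (k : ℕ) : ℝ :=
  (-1) ^ k * p.coeff (p.natDegree - k) / (p.natDegree.choose k : ℝ)

theorem eq_sum_normCoeff (p : Polynomial ℝ) :
    p = ∑ k ∈ Finset.range (p.natDegree + 1), Polynomial.X ^ (p.natDegree - k) *
      Polynomial.C ((-1) ^ k * (p.natDegree.choose k : ℝ) * normCoeff p k) := by
  conv_lhs => rw [p.as_sum_range_C_mul_X_pow, ← Finset.sum_range_reflect]
  refine Finset.sum_congr rfl fun k hk => ?_
  have hk' : k ≤ p.natDegree := Nat.lt_succ_iff.1 (Finset.mem_range.1 hk)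
  have h0 : (p.natDegree.choose k : ℝ) ≠ 0 := by
    exact_mod_cast (Nat.choose_pos hk').ne'
  have h1 : ((-1 : ℝ) ^ k) * (-1) ^ k = 1 := by rw [← mul_pow]; simp
  have h2 : (-1) ^ k * (p.natDegree.choose k : ℝ) * normCoeff p k
      = p.coeff (p.natDegree - k) := by
    unfold normCoeff
    field_simp
    linear_combination p.coeff (p.natDegree - k) * h1
  rw [h2, show p.natDegree + 1 - 1 - k = p.natDegree - k by omega, mul_comm]

/-- The finite free cumulants (meaningful for `1 ≤ n ≤ d = deg p`)
`κ_n(p) = (-d)^{n-1}/(n-1)! ∑_{π ∈ P(n)} (-1)^{|π|-1} (|π|-1)! ∏_{V ∈ π} a_{|V|}`. -/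
def finiteFreeCumulant (p : Polynomial ℝ) (n : ℕ) : ℝ :=
  (-(p.natDegree : ℝ)) ^ (n - 1) / ((n - 1).factorial : ℝ) *
    ∑ π : SetPartition n, (-1) ^ (π.parts.card - 1) * ((π.parts.card - 1).factorial : ℝ) *
      blockProd (normCoeff p) π

/-! ### Asymptotic expansions along a sequence of polynomials -/

/-- The sequence `p` converges in moments to `μ`, which has finite moments of all orders. -/
def HasLimitingDistribution (p : ℕ → Polynomial ℝ) (μ : Measure ℝ) : Prop :=
  (∀ n : ℕ, Integrable (fun x : ℝ => x ^ n) μ) ∧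
    ∀ n : ℕ, Tendsto (fun d => rootMoment (p d) n) atTop (𝓝 (moment μ n))

/-- `m_n(p_d) = m_n(μ) + m'_n / d + o(1/d)` as `d → ∞`, for all `n ≥ 1`. -/
def HasInfinitesimalMoments (p : ℕ → Polynomial ℝ) (μ : Measure ℝ) (m' : ℕ → ℝ) : Prop :=
  ∀ n : ℕ, 1 ≤ n →
    (fun d : ℕ => rootMoment (p d) n - (moment μ n + 1 / (d : ℝ) * m' n))
      =o[atTop] (fun d : ℕ => 1 / (d : ℝ))

/-- `κ_n(p_d) = r_n(μ) + r̂_n / d + o(1/d)` as `d → ∞` (`d ≥ n`), for all `n ≥ 1`. -/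
def HasCumulantFluctuations (p : ℕ → Polynomial ℝ) (μ : Measure ℝ) (rhat : ℕ → ℝ) : Prop :=
  ∀ n : ℕ, 1 ≤ n →
    (fun d : ℕ => finiteFreeCumulant (p d) n - (freeCumulant μ n + 1 / (d : ℝ) * rhat n))
      =o[atTop] (fun d : ℕ => 1 / (d : ℝ))

/-- The right-hand side
`∑_{π ∈ NC(n)} ∑_{V ∈ π} r̂_{|V|} ∏_{W ∈ π, W ≠ V} r_{|W|}
  - (n/2) ∑_{t + s = n, t, s ≥ 1} ∑_{σ ∈ S_NC(t,s)} r_σ / (t s)`. -/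
def infinitesimalMomentFormula (r rhat : ℕ → ℝ) (n : ℕ) : ℝ :=
  (∑ π ∈ NC n, ∑ V ∈ π.parts, (rhat V.card * ∏ W ∈ π.parts.erase V, r W.card))
    - (n : ℝ) / 2 *
      ∑ ts ∈ (Finset.HasAntidiagonal.antidiagonal n).filter (fun ts => 1 ≤ ts.1 ∧ 1 ≤ ts.2),
        ∑ σ ∈ annularNC ts.1 ts.2, cycleProd r σ / ((ts.1 : ℝ) * (ts.2 : ℝ))

end

end FiniteFree

namespace FiniteFree

noncomputable section

/-! Everything rests on one exact identity. For `n + 1 ≤ d`, the moment `m_{n+1}(p_d)` equals `1/n!`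
times the sum, over pairs `(σ, τ)` in `S_{n+1}` generating a transitive group, of `κ_σ
(-1/d)^(n+2-|σ|-|τ|)` (`rootMoment_eq_genusExpansion`).

The identity comes from an exponential formula. Inverting the cumulants writes `a_n` as a weighted
sum over all permutations, and the falling factorial `d(d-1)⋯(d-n+1)` is another such sum. Their
product is `n! e_n` of the roots, hence a sum over all pairs `(σ, τ)`. Splitting off the orbit of
one point gives a recursion of the same form as Newton's identities, so the transitive pairs must
give the power sums, up to `n! (-1)^n`.

The exponent is then read as a genus. For transitive pairs `|σ| + |τ| + |στ| ≤ n + 3`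
(`cycleCount_add_add_le`), so no negative powers of `1/d` occur. At order zero `στ` is a full cycle
and `σ` runs over the non-crossing partitions (`sum_genus_zero_eq_sum_NC`). At order one parity
forces `στ` to have exactly two cycles, and grouping by their lengths produces the annular sum with
its factor `n/2` (`sum_relativeSum_annular`). All other terms carry `1/d^2`.

Substituting first-order expansions of the cumulants therefore gives (1) from (2), together with
`(*)`. For the converse, the identity is affine in the top cumulant, with a coefficient tending to
`1`, and otherwise involves only lower cumulants; induction on `n` solves for it
(`HasInfinitesimalMoments.exists_expansion`). The leading term is the free cumulant because the
moment-cumulant formula is triangular. Triangularity of `(*)` in `r̂` settles the last claim. -/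

open Equiv Finset Classical in
/-- The partition of the ground set into the cycles of a permutation. -/
def cyclePartition {α : Type*} [Fintype α] [DecidableEq α] (σ : Perm α) :
    Finpartition (univ : Finset α) :=
  Finpartition.ofSetoid (Perm.SameCycle.setoid σ)

/-! ### Cycles as blocks of a partition; weights, counts and parity. -/

section Cycles

open Equiv Finset

variable {α β : Type*} [Fintype α] [DecidableEq α] [Fintype β] [DecidableEq β]

theorem mem_part_cyclePartition {σ : Perm α} {a b : α} :
    b ∈ (cyclePartition σ).part a ↔ σ.SameCycle a b := by
  classical
  exact Finpartition.mem_part_ofSetoid_iff_rel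

theorem mem_parts_cyclePartition {σ : Perm α} {V : Finset α} :
    V ∈ (cyclePartition σ).parts ↔ ∃ a, V = univ.filter (σ.SameCycle a) := by
  classical
  have h : (cyclePartition σ).parts =
      univ.image fun a => univ.filter fun b => (Perm.SameCycle.setoid σ) a b := by
    unfold cyclePartition Finpartition.ofSetoid
    rw [Finpartition.ofSetSetoid_parts]
  rw [h]
  simp only [mem_image, mem_univ, true_and]
  refine exists_congr fun a => eq_comm.trans ?_
  have : (univ.filter fun b => (Perm.SameCycle.setoid σ) a b) = univ.filter (σ.SameCycle a) :=
    Finset.filter_congr fun b _ => Iff.rfl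
  rw [this]

theorem parts_cyclePartition (σ : Perm α) :
    (cyclePartition σ).parts =
      σ.cycleFactorsFinset.image Perm.support ∪ (univ \ σ.support).image singleton := by
  ext V
  simp only [mem_parts_cyclePartition, mem_union, mem_image, Finset.mem_sdiff, mem_univ, true_and,
    Perm.mem_support, not_not]
  constructor
  · rintro ⟨a, rfl⟩
    by_cases ha : σ a = a
    · right
      refine ⟨a, ha, ?_⟩
      ext b
      simp only [mem_singleton, mem_filter, mem_univ, true_and]
      constructor
      · rintro rfl; exact Perm.SameCycle.refl _ _
      · intro h; exact (h.eq_of_left ha).symm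
    · left
      refine ⟨σ.cycleOf a, Perm.cycleOf_mem_cycleFactorsFinset_iff.2 (Perm.mem_support.2 ha), ?_⟩
      ext b
      simp only [mem_filter, mem_univ, true_and]
      rw [Perm.mem_support_cycleOf_iff]
      exact ⟨fun h => h.1, fun h => ⟨h, Perm.mem_support.2 ha⟩⟩
  · rintro (⟨c, hc, rfl⟩ | ⟨a, ha, rfl⟩)
    · have hcyc := (Perm.mem_cycleFactorsFinset_iff.1 hc).1
      obtain ⟨a, ha⟩ := hcyc.nonempty_support
      refine ⟨a, ?_⟩
      have := Perm.cycle_is_cycleOf ha hc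
      ext b
      rw [this, Perm.mem_support_cycleOf_iff]
      simp only [mem_filter, mem_univ, true_and]
      exact ⟨fun h => h.1, fun h => ⟨h, Perm.mem_cycleFactorsFinset_support_le hc ha⟩⟩
    · refine ⟨a, ?_⟩
      ext b
      simp only [mem_singleton, mem_filter, mem_univ, true_and]
      constructor
      · rintro rfl; exact Perm.SameCycle.refl _ _
      · intro h; exact (h.eq_of_left ha).symm

/-- Mathlib stores the cycle type as a multiset of lengths, while the combinatorics below needs the
cycles as subsets. The blocks are the supports of the cycle factors together with the singletons of
fixed points. -/
theorem partition_parts_eq_map_card (σ : Perm α) :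
    σ.partition.parts = (cyclePartition σ).parts.val.map Finset.card := by
  have hdisj : Disjoint (σ.cycleFactorsFinset.image Perm.support)
      ((univ \ σ.support).image (singleton : α → Finset α)) := by
    rw [Finset.disjoint_left]
    intro V hV hV'
    simp only [mem_image, Finset.mem_sdiff, mem_univ, true_and] at hV hV'
    obtain ⟨c, hc, rfl⟩ := hV
    obtain ⟨a, ha, hac⟩ := hV'
    exact ha (Perm.mem_cycleFactorsFinset_support_le hc (by rw [← hac]; simp))
  have hinj : Set.InjOn Perm.support (σ.cycleFactorsFinset : Set (Perm α)) := by
    intro c hc c' hc' h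
    obtain ⟨a, ha⟩ := (Perm.mem_cycleFactorsFinset_iff.1 hc).1.nonempty_support
    rw [Perm.cycle_is_cycleOf ha hc, Perm.cycle_is_cycleOf (h ▸ ha) hc']
  rw [parts_cyclePartition, ← Finset.disjUnion_eq_union _ _ hdisj, Finset.disjUnion_val,
    Multiset.map_add, Finset.image_val_of_injOn hinj,
    Finset.image_val_of_injOn (Finset.singleton_injective.injOn), Multiset.map_map,
    Multiset.map_map, Perm.parts_partition, Perm.cycleType_def]
  congr 1
  rw [show (Finset.card ∘ (singleton : α → Finset α)) = fun _ => 1 from funext fun _ => by simp,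
    Multiset.map_const', Finset.card_val, Finset.card_sdiff_of_subset (subset_univ _),
    Finset.card_univ]

/-- The product of the weights of the cycles (fixed points included) of a permutation. -/
def cycleWeight (u : ℕ → ℝ) (σ : Perm α) : ℝ := (σ.partition.parts.map u).prod

/-- The number of cycles (fixed points included) of a permutation. -/
def cycleCount (σ : Perm α) : ℕ := σ.partition.parts.card

theorem cycleWeight_eq_prod (u : ℕ → ℝ) (σ : Perm α) :
    cycleWeight u σ = ∏ V ∈ (cyclePartition σ).parts, u V.card := by
  rw [cycleWeight, partition_parts_eq_map_card, Multiset.map_map]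
  rfl

theorem cycleCount_eq_card_parts (σ : Perm α) :
    cycleCount σ = (cyclePartition σ).parts.card := by
  rw [cycleCount, partition_parts_eq_map_card, Multiset.card_map, Finset.card_val]

theorem cycleCount_pos [Nonempty α] (σ : Perm α) : 1 ≤ cycleCount σ := by
  rw [cycleCount_eq_card_parts]
  exact Finset.card_pos.2 (Finpartition.parts_nonempty _ Finset.univ_nonempty.ne_empty)

theorem cycleCount_le (σ : Perm α) : cycleCount σ ≤ Fintype.card α := by
  rw [cycleCount_eq_card_parts]
  exact Finpartition.card_parts_le_card _

theorem partition_parts_conj (g σ : Perm α) :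
    (g * σ * g⁻¹).partition.parts = σ.partition.parts := by
  rw [Perm.parts_partition, Perm.parts_partition, Perm.cycleType_conj, Perm.card_support_conj]

theorem partition_parts_permCongr (e : α ≃ β) (σ : Perm α) :
    (e.permCongr σ).partition.parts = σ.partition.parts := by
  let f : α ≃ Subtype (fun _ : β => True) := e.trans (Equiv.subtypeUnivEquiv fun _ => trivial).symm
  have h : e.permCongr σ = σ.extendDomain f := by
    ext b
    obtain ⟨a, rfl⟩ := e.surjective b
    have : e a = (f a : β) := rfl
    rw [this, Perm.extendDomain_apply_image, ← this]
    simp [f]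
  rw [Perm.parts_partition, Perm.parts_partition, h, Perm.cycleType_extendDomain,
    Perm.card_support_extend_domain, Fintype.card_congr e]

/-- The glued permutation is a product of two disjoint ones, so nontrivial cycles add; the fixed
points are then matched by counting. This makes the weights multiplicative over invariant subsets.
-/
theorem partition_parts_subtypeCongr (p : α → Prop) [DecidablePred p]
    [Fintype {a // p a}] [Fintype {a // ¬p a}]
    (σ : Perm {a // p a}) (τ : Perm {a // ¬p a}) :
    (Perm.subtypeCongr σ τ).partition.parts = σ.partition.parts + τ.partition.parts := by
  have h : Perm.subtypeCongr σ τ = Perm.ofSubtype σ * Perm.ofSubtype τ := by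
    ext a
    by_cases ha : p a
    · rw [Perm.subtypeCongr.left_apply _ _ ha, Perm.mul_apply,
        Perm.ofSubtype_apply_of_not_mem τ (not_not.2 ha), Perm.ofSubtype_apply_of_mem σ ha]
    · rw [Perm.subtypeCongr.right_apply _ _ ha, Perm.mul_apply, Perm.ofSubtype_apply_of_mem τ ha,
        Perm.ofSubtype_apply_of_not_mem σ (τ ⟨a, ha⟩).2]
  have hd : Perm.Disjoint (Perm.ofSubtype σ) (Perm.ofSubtype τ) := by
    intro a
    by_cases ha : p a
    · right; exact Perm.ofSubtype_apply_of_not_mem τ (not_not.2 ha)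
    · left; exact Perm.ofSubtype_apply_of_not_mem σ ha
  have hc : Fintype.card α = Fintype.card {a // p a} + Fintype.card {a // ¬p a} := by
    rw [Fintype.card_subtype_compl, Nat.add_sub_cancel' (Fintype.card_subtype_le p)]
  have hs : σ.support.card ≤ Fintype.card {a // p a} := Finset.card_le_univ _
  have ht : τ.support.card ≤ Fintype.card {a // ¬p a} := Finset.card_le_univ _
  rw [Perm.parts_partition, Perm.parts_partition, Perm.parts_partition, h, hd.cycleType_mul,
    hd.card_support_mul, Perm.cycleType_ofSubtype, Perm.cycleType_ofSubtype,
    ← Perm.sum_cycleType, ← Perm.sum_cycleType, Perm.cycleType_ofSubtype, Perm.cycleType_ofSubtype,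
    Perm.sum_cycleType, Perm.sum_cycleType, hc,
    show Fintype.card {a // p a} + Fintype.card {a // ¬p a} - (σ.support.card + τ.support.card) =
      (Fintype.card {a // p a} - σ.support.card) + (Fintype.card {a // ¬p a} - τ.support.card) by
      omega, Multiset.replicate_add]
  abel

theorem cycleWeight_permCongr (u : ℕ → ℝ) (e : α ≃ β) (σ : Perm α) :
    cycleWeight u (e.permCongr σ) = cycleWeight u σ := by
  rw [cycleWeight, cycleWeight, partition_parts_permCongr]

theorem cycleWeight_conj (u : ℕ → ℝ) (g σ : Perm α) :
    cycleWeight u (g * σ * g⁻¹) = cycleWeight u σ := by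
  rw [cycleWeight, cycleWeight, partition_parts_conj]

theorem cycleCount_conj (g σ : Perm α) : cycleCount (g * σ * g⁻¹) = cycleCount σ := by
  rw [cycleCount, cycleCount, partition_parts_conj]

theorem cycleWeight_subtypeCongr (u : ℕ → ℝ) (p : α → Prop) [DecidablePred p]
    [Fintype {a // p a}] [Fintype {a // ¬p a}]
    (σ : Perm {a // p a}) (τ : Perm {a // ¬p a}) :
    cycleWeight u (Perm.subtypeCongr σ τ) = cycleWeight u σ * cycleWeight u τ := by
  rw [cycleWeight, partition_parts_subtypeCongr, Multiset.map_add, Multiset.prod_add]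
  rfl

theorem sign_eq_neg_one_pow (σ : Perm α) :
    (Perm.sign σ : ℤ) = (-1) ^ (Fintype.card α + cycleCount σ) := by
  have h1 : σ.support.card ≤ Fintype.card α := Finset.card_le_univ _
  rw [Perm.sign_of_cycleType, Perm.sum_cycleType, cycleCount, Perm.parts_partition,
    Multiset.card_add, Multiset.card_replicate]
  push_cast
  obtain ⟨k, hk⟩ := Nat.exists_eq_add_of_le h1
  rw [hk, Nat.add_sub_cancel_left,
    show σ.support.card + k + (Multiset.card σ.cycleType + k) =
      σ.support.card + Multiset.card σ.cycleType + 2 * k by ring, pow_add _ _ (2 * k), pow_mul]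
  simp

/-- The parity constraint on cycle counts coming from multiplicativity of the sign. -/
theorem cycleCount_mul_parity (σ τ : Perm α) :
    Even (Fintype.card α + cycleCount σ + cycleCount τ + cycleCount (σ * τ)) := by
  have h := Perm.sign_mul σ τ
  have h' : (Perm.sign (σ * τ) : ℤ) = Perm.sign σ * Perm.sign τ := by rw [h]; rfl
  rw [sign_eq_neg_one_pow, sign_eq_neg_one_pow, sign_eq_neg_one_pow, ← pow_add] at h'
  have h2 : ((-1 : ℤ)) ^ (Fintype.card α + cycleCount σ + cycleCount τ + cycleCount (σ * τ)) = 1 := by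
    have h3 : ((-1 : ℤ)) ^ ((Fintype.card α + cycleCount (σ * τ)) +
        (Fintype.card α + cycleCount σ + (Fintype.card α + cycleCount τ))) = 1 := by
      rw [pow_add, h', ← pow_add]
      exact Even.neg_one_pow ⟨_, rfl⟩
    rw [show Fintype.card α + cycleCount (σ * τ) +
        (Fintype.card α + cycleCount σ + (Fintype.card α + cycleCount τ)) =
        (Fintype.card α + cycleCount σ + cycleCount τ + cycleCount (σ * τ))
          + 2 * Fintype.card α by ring, pow_add, pow_mul] at h3
    simpa using h3
  by_contra hodd
  rw [Nat.not_even_iff_odd] at hodd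
  rw [hodd.neg_one_pow] at h2
  norm_num at h2

end Cycles

/-! ### The genus inequality by linear algebra on invariant functions. -/

section Genus

set_option linter.unusedSectionVars false

open Equiv Finset

variable {α : Type*} [Fintype α] [DecidableEq α]

/-- The functions that are constant on the cycles of a permutation. -/
def invariantFunctions (σ : Perm α) : Submodule ℝ (α → ℝ) where
  carrier := {f | ∀ a, f (σ a) = f a}
  add_mem' hf hg a := by simp [hf a, hg a]
  zero_mem' a := rfl
  smul_mem' c f hf a := by simp [hf a]

theorem eq_of_sameCycle {σ : Perm α} {f : α → ℝ} (hf : f ∈ invariantFunctions σ) {a b : α}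
    (h : σ.SameCycle a b) : f a = f b := by
  obtain ⟨k, -, rfl⟩ := h.exists_pow_eq'
  induction k with
  | zero => rfl
  | succ k ih =>
    rw [ih (Perm.sameCycle_pow_right.2 (Perm.SameCycle.refl _ _)), pow_succ', Perm.mul_apply, hf]

/-- Invariant functions are exactly those that factor through the quotient onto cycles. Cycle counts
thus become dimensions. -/
theorem finrank_invariantFunctions (σ : Perm α) :
    Module.finrank ℝ (invariantFunctions σ) = cycleCount σ := by
  let p : α → (cyclePartition σ).parts := fun a =>
    ⟨(cyclePartition σ).part a, (Finpartition.part_mem _).2 (mem_univ a)⟩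
  have hp : Function.Surjective p := by
    rintro ⟨V, hV⟩
    obtain ⟨a, -, ha⟩ := (cyclePartition σ).part_surjOn hV
    exact ⟨a, Subtype.ext ha⟩
  have hpe : ∀ a b, p a = p b ↔ σ.SameCycle a b := by
    intro a b
    rw [Subtype.ext_iff, ← mem_part_cyclePartition,
      Finpartition.mem_part_iff_part_eq_part _ (mem_univ b) (mem_univ a)]
    exact eq_comm
  have hrange : LinearMap.range (LinearMap.funLeft ℝ ℝ p) = invariantFunctions σ := by
    ext f
    rw [LinearMap.mem_range]
    constructor
    · rintro ⟨g, rfl⟩ a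
      have : p (σ a) = p a := (hpe _ _).2 (Perm.sameCycle_apply_left.2 (Perm.SameCycle.refl _ _))
      simp [LinearMap.funLeft_apply, this]
    · intro hf
      refine ⟨fun q => f (Function.surjInv hp q), ?_⟩
      ext a
      rw [LinearMap.funLeft_apply]
      exact eq_of_sameCycle hf ((hpe _ _).1 (Function.surjInv_eq hp (p a)))
  rw [← hrange, LinearMap.finrank_range_of_inj (LinearMap.funLeft_injective_of_surjective _ _ _ hp),
    Module.finrank_fintype_fun_eq_card, Fintype.card_coe, cycleCount_eq_card_parts]

/-- The group generated by two permutations acts transitively. -/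
abbrev JointlyTransitive (σ τ : Perm α) : Prop :=
  MulAction.IsPretransitive (Subgroup.closure {σ, τ}) α

theorem JointlyTransitive.eq_of_invariant {σ τ : Perm α} (h : JointlyTransitive σ τ)
    {f : α → ℝ} (hσ : f ∈ invariantFunctions σ) (hτ : f ∈ invariantFunctions τ) (a b : α) :
    f a = f b := by
  obtain ⟨⟨g, hg⟩, rfl⟩ := h.exists_smul_eq a b
  change f a = f (g a)
  induction hg using Subgroup.closure_induction generalizing a with
  | mem x hx =>
    rcases hx with rfl | rfl
    · exact (hσ a).symm
    · exact (hτ a).symm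
  | one => rfl
  | mul x y _ _ hx hy => rw [Perm.mul_apply, ← hx, ← hy]
  | inv x _ hx => rw [hx (x⁻¹ a)]; simp

theorem finrank_le_one_of_constant (S : Submodule ℝ (α → ℝ)) (h : ∀ f ∈ S, ∀ a b, f a = f b) :
    Module.finrank ℝ S ≤ 1 := by
  rcases isEmpty_or_nonempty α with hα | ⟨⟨a⟩⟩
  · have : Subsingleton S := ⟨fun x y => Subtype.ext (Subsingleton.elim _ _)⟩
    rw [Module.finrank_zero_of_subsingleton]; exact zero_le_one
  · have : S ≤ Submodule.span ℝ {fun _ => (1 : ℝ)} := by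
      intro f hf
      refine Submodule.mem_span_singleton.2 ⟨f a, ?_⟩
      ext b
      simp [h f hf a b]
    exact (Submodule.finrank_mono this).trans (finrank_span_le_card _ |>.trans (by simp))

/-- By transitivity only constants are invariant under both permutations, so the two subspaces meet
in dimension at most one. -/
theorem cycleCount_add_le_finrank_sup {σ τ : Perm α} (h : JointlyTransitive σ τ) :
    cycleCount σ + cycleCount τ ≤
      Module.finrank ℝ (invariantFunctions σ ⊔ invariantFunctions τ : Submodule ℝ (α → ℝ)) + 1 := by
  rw [← finrank_invariantFunctions, ← finrank_invariantFunctions,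
    ← Submodule.finrank_sup_add_finrank_inf_eq]
  gcongr
  exact finrank_le_one_of_constant _ fun f hf => h.eq_of_invariant hf.1 hf.2

/-- The genus inequality: a transitive triple of permutations with product one has Euler
characteristic at most two. -/
theorem cycleCount_add_add_le {σ τ : Perm α} (h : JointlyTransitive σ τ) :
    cycleCount σ + cycleCount τ + cycleCount (σ * τ) ≤ Fintype.card α + 2 := by
  set A := invariantFunctions σ
  set B := invariantFunctions τ
  set C := invariantFunctions (σ * τ)
  -- On the `στ`-invariant functions, `l ↦ l - l ∘ τ⁻¹` kills only constants and has image
  -- orthogonal to `A ⊔ B`. The dimensions `|στ| - 1` and `|σ| + |τ| - 1` therefore fit together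
  -- inside `α → ℝ`.
  let L₀ : (α → ℝ) →ₗ[ℝ] (α → ℝ) := LinearMap.id - LinearMap.funLeft ℝ ℝ (τ⁻¹ : Perm α)
  let L : C →ₗ[ℝ] (α → ℝ) := L₀ ∘ₗ C.subtype
  have hL : ∀ (l : C) a, L l a = (l : α → ℝ) a - (l : α → ℝ) (τ⁻¹ a) := fun l a => rfl
  have hker : Module.finrank ℝ (LinearMap.ker L) ≤ 1 := by
    have : Module.finrank ℝ ((LinearMap.ker L).map C.subtype) ≤ 1 := by
      refine finrank_le_one_of_constant _ ?_
      rintro _ ⟨l, hl, rfl⟩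
      have hτ : (l : α → ℝ) ∈ B := by
        intro a
        have := congrFun (LinearMap.mem_ker.1 hl) (τ a)
        rw [hL] at this
        simpa [sub_eq_zero] using this
      have hσ : (l : α → ℝ) ∈ A := by
        intro a
        obtain ⟨b, rfl⟩ := τ.surjective a
        rw [hτ b]
        exact l.2 b
      exact h.eq_of_invariant hσ hτ
    rwa [Submodule.finrank_map_subtype_eq] at this
  have horth : ∀ l : C, ∀ f ∈ A ⊔ B, ∑ a, L l a * f a = 0 := by
    intro l f hf
    obtain ⟨g, hg, k, hk, rfl⟩ := Submodule.mem_sup.1 hf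
    have h1 : ∀ f : α → ℝ, ∑ a, L l a * f a = ∑ a, (l : α → ℝ) a * (f (σ (τ a)) - f (τ a)) := by
      intro f
      simp only [hL, sub_mul, mul_sub, Finset.sum_sub_distrib]
      congr 1
      · rw [← Equiv.sum_comp (σ * τ)]
        refine Finset.sum_congr rfl fun a _ => ?_
        rw [l.2 a]; rfl
      · rw [← Equiv.sum_comp τ]
        simp
    rw [h1]
    -- The `σ`-invariant part drops out; what is left of the `τ`-invariant part is a coboundary for
    -- `στ`, and pairing it with the `στ`-invariant `l` gives zero.
    have h2 : ∀ a, (g + k) (σ (τ a)) - (g + k) (τ a) = k ((σ * τ) a) - k a := by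
      intro a
      simp only [Pi.add_apply, hg (τ a), hk a, Perm.mul_apply]
      ring
    simp only [h2, mul_sub, Finset.sum_sub_distrib]
    rw [sub_eq_zero, ← Equiv.sum_comp (σ * τ) fun a => (l : α → ℝ) a * k a]
    refine Finset.sum_congr rfl fun a _ => ?_
    rw [l.2 a]
  have hdisj : LinearMap.range L ⊓ (A ⊔ B) = ⊥ := by
    rw [Submodule.eq_bot_iff]
    rintro f ⟨⟨l, hl⟩, hf⟩
    have := horth l f hf
    rw [hl] at this
    ext a
    have h0 := (Finset.sum_eq_zero_iff_of_nonneg fun a _ => mul_self_nonneg (f a)).1 this a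
      (mem_univ a)
    simpa using h0
  have hdim := Submodule.finrank_sup_add_finrank_inf_eq (LinearMap.range L) (A ⊔ B)
  rw [hdisj, finrank_bot, add_zero] at hdim
  have hle : Module.finrank ℝ (LinearMap.range L ⊔ (A ⊔ B) : Submodule ℝ (α → ℝ)) ≤
      Fintype.card α := by
    rw [← Module.finrank_fintype_fun_eq_card ℝ]
    exact Submodule.finrank_le _
  have hrk := LinearMap.finrank_range_add_finrank_ker L
  have hC : Module.finrank ℝ C = _ := finrank_invariantFunctions (σ * τ)
  have hAB : _ ≤ Module.finrank ℝ (A ⊔ B : Submodule ℝ (α → ℝ)) + 1 :=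
    cycleCount_add_le_finrank_sup h
  omega

/-- Genus zero is the extremal case of the dimension count. Splitting an arbitrary function into the
two kinds of invariant functions is what later recovers the planar structure. -/
theorem sup_invariantFunctions_eq_top {σ τ : Perm α} (h : JointlyTransitive σ τ)
    (hc : cycleCount σ + cycleCount τ = Fintype.card α + 1) :
    invariantFunctions σ ⊔ invariantFunctions τ = ⊤ := by
  have := cycleCount_add_le_finrank_sup h
  refine Submodule.eq_top_of_finrank_eq (le_antisymm (Submodule.finrank_le _) ?_)
  rw [Module.finrank_fintype_fun_eq_card]
  omega

theorem cycleCount_add_le {σ τ : Perm α} [Nonempty α] (h : JointlyTransitive σ τ) :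
    cycleCount σ + cycleCount τ ≤ Fintype.card α + 1 := by
  have h1 := cycleCount_add_add_le h
  have h2 := cycleCount_pos (σ * τ)
  omega

theorem cycleCount_mul_eq_one {σ τ : Perm α} [Nonempty α] (h : JointlyTransitive σ τ)
    (hc : cycleCount σ + cycleCount τ = Fintype.card α + 1) : cycleCount (σ * τ) = 1 := by
  have h1 := cycleCount_add_add_le h
  have h2 := cycleCount_pos (σ * τ)
  omega

/-- The genus inequality leaves only one or two cycles, and the sign excludes one. -/
theorem cycleCount_mul_eq_two {σ τ : Perm α} [Nonempty α] (h : JointlyTransitive σ τ)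
    (hc : cycleCount σ + cycleCount τ = Fintype.card α) : cycleCount (σ * τ) = 2 := by
  have h1 := cycleCount_add_add_le h
  have h2 := cycleCount_pos (σ * τ)
  have h3 := cycleCount_mul_parity σ τ
  rw [Nat.even_iff] at h3
  omega

end Genus

/-! ### Biane's bijection between genus-zero permutations and non-crossing partitions. -/

section NonCrossing

open Equiv Finset

/-- `σ` maps every point to the cyclically next point of its block. -/
def IsCyclicSuccessor {n : ℕ} (π : SetPartition n) (σ : Perm (Fin n)) : Prop :=
  ∀ a, σ a ∈ π.part a ∧ ((a < σ a ∧ ∀ j ∈ π.part a, a < j → σ a ≤ j) ∨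
    ∀ j ∈ π.part a, σ a ≤ j ∧ j ≤ a)

theorem mem_part_comm {n : ℕ} {π : SetPartition n} {a b : Fin n} :
    b ∈ π.part a ↔ π.part b = π.part a :=
  π.mem_part_iff_part_eq_part (mem_univ b) (mem_univ a)

theorem self_mem_part {n : ℕ} (π : SetPartition n) (a : Fin n) : a ∈ π.part a :=
  π.mem_part_self.2 (mem_univ a)

theorem IsCyclicSuccessor.unique {n : ℕ} {π : SetPartition n} {σ τ : Perm (Fin n)}
    (hσ : IsCyclicSuccessor π σ) (hτ : IsCyclicSuccessor π τ) : σ = τ := by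
  ext1 a
  obtain ⟨hs, h⟩ := hσ a
  obtain ⟨ht, k⟩ := hτ a
  rcases h with ⟨h1, h2⟩ | h <;> rcases k with ⟨k1, k2⟩ | k
  · exact le_antisymm (h2 _ ht k1) (k2 _ hs h1)
  · exact absurd (k _ hs).2 (not_le.2 h1)
  · exact absurd (h _ ht).2 (not_le.2 k1)
  · exact le_antisymm (h _ ht).1 (k _ hs).1

/-- Going backwards along `σ` from any point decreases the value until the minimum of its block is
reached, so a block is a single cycle. -/
theorem IsCyclicSuccessor.cyclePartition_eq {n : ℕ} {π : SetPartition n} {σ : Perm (Fin n)}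
    (hσ : IsCyclicSuccessor π σ) : cyclePartition σ = π := by
  have hpart : ∀ a, π.part (σ a) = π.part a := fun a => mem_part_comm.1 (hσ a).1
  have hsame : ∀ a b, σ.SameCycle a b → π.part b = π.part a := by
    intro a b h
    obtain ⟨k, -, rfl⟩ := h.exists_pow_eq'
    clear h
    induction k with
    | zero => rfl
    | succ k ih => rw [pow_succ', Perm.mul_apply, hpart, ih]
  have hmin : ∀ m : ℕ, ∀ a b : Fin n, (b : ℕ) = m → π.part b = π.part a →
      (∀ j ∈ π.part a, a ≤ j) → σ.SameCycle a b := by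
    intro m
    induction m using Nat.strong_induction_on with
    | _ m ih =>
      intro a b hb hab hmin
      obtain ⟨c, rfl⟩ := σ.surjective b
      rw [hpart] at hab
      rw [Perm.sameCycle_apply_right]
      rcases (hσ c).2 with h | h
      · exact ih c (by have := Fin.lt_def.1 h.1; omega) a c rfl hab hmin
      · have h1 : σ c ≤ a := (h a (by rw [hab]; exact self_mem_part π a)).1
        have h2 : a ≤ σ c := hmin _ (by rw [← hab]; exact (hσ c).1)
        rw [← Perm.sameCycle_apply_right, le_antisymm h1 h2]
  have hiff : ∀ a b, σ.SameCycle a b ↔ π.part b = π.part a := by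
    intro a b
    refine ⟨hsame a b, fun h => ?_⟩
    let c := (π.part a).min' ⟨a, self_mem_part π a⟩
    have hc : π.part c = π.part a := mem_part_comm.1 (Finset.min'_mem _ _)
    have hcmin : ∀ j ∈ π.part c, c ≤ j := by
      rw [hc]
      exact fun j hj => Finset.min'_le _ _ hj
    exact (hmin _ c a rfl hc.symm hcmin).symm.trans (hmin _ c b rfl (h.trans hc.symm) hcmin)
  have hpe : ∀ a, (cyclePartition σ).part a = π.part a := by
    intro a
    ext b
    rw [mem_part_cyclePartition, hiff, mem_part_comm]
  ext V
  constructor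
  · intro hV
    obtain ⟨a, -, rfl⟩ := (cyclePartition σ).part_surjOn hV
    rw [hpe]
    exact π.part_mem.2 (mem_univ a)
  · intro hV
    obtain ⟨a, -, rfl⟩ := π.part_surjOn hV
    rw [← hpe]
    exact (cyclePartition σ).part_mem.2 (mem_univ a)

theorem exists_isCyclicSuccessor {n : ℕ} (π : SetPartition n) :
    ∃ σ : Perm (Fin n), IsCyclicSuccessor π σ := by
  have h : ∀ a, ∃ b, b ∈ π.part a ∧ ((a < b ∧ ∀ j ∈ π.part a, a < j → b ≤ j) ∨
      ∀ j ∈ π.part a, b ≤ j ∧ j ≤ a) := by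
    intro a
    by_cases hne : ((π.part a).filter (a < ·)).Nonempty
    · have hm := Finset.min'_mem _ hne
      rw [Finset.mem_filter] at hm
      exact ⟨_, hm.1, Or.inl ⟨hm.2, fun j hj haj =>
        Finset.min'_le _ _ (Finset.mem_filter.2 ⟨hj, haj⟩)⟩⟩
    · refine ⟨(π.part a).min' ⟨a, self_mem_part π a⟩, Finset.min'_mem _ _, Or.inr fun j hj =>
        ⟨Finset.min'_le _ _ hj, ?_⟩⟩
      by_contra hja
      exact hne ⟨j, Finset.mem_filter.2 ⟨hj, not_le.1 hja⟩⟩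
  choose f hf using h
  have hinj : Function.Injective f := by
    have key : ∀ a b, a < b → f a ≠ f b := by
      intro a b hab heq
      have hp : π.part b = π.part a := by
        rw [← mem_part_comm.1 (hf a).1, ← mem_part_comm.1 (hf b).1, heq]
      have hba : b ∈ π.part a := mem_part_comm.2 hp
      have hab' : a ∈ π.part b := mem_part_comm.2 hp.symm
      rcases (hf a).2 with h1 | h1
      · have h2 := h1.2 b hba hab
        rcases (hf b).2 with h3 | h3
        · exact absurd (heq ▸ h3.1) (not_lt.2 h2)
        · exact absurd (heq ▸ (h3 a hab').1) (not_le.2 h1.1)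
      · exact absurd (h1 b hba).2 (not_le.2 hab)
    intro a b heq
    rcases lt_trichotomy a b with h | h | h
    · exact absurd heq (key a b h)
    · exact h
    · exact absurd heq.symm (key b a h)
  exact ⟨Equiv.ofBijective f (Finite.injective_iff_bijective.1 hinj), hf⟩

/-- A point that is not an ascent of `σ` is the maximum of its block, so there is at most one such
point per block. -/
theorem IsCyclicSuccessor.card_parts_le {n : ℕ} {π : SetPartition n} {σ : Perm (Fin n)}
    (hσ : IsCyclicSuccessor π σ) :
    n ≤ (univ.filter fun a => a < σ a).card + π.parts.card := by
  have h1 : (univ.filter fun a => ¬ a < σ a).card ≤ π.parts.card := by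
    refine Finset.card_le_card_of_injOn π.part (fun a _ => π.part_mem.2 (mem_univ a)) ?_
    have hmax : ∀ a, ¬ a < σ a → ∀ j ∈ π.part a, j ≤ a := by
      intro a ha j hj
      rcases (hσ a).2 with h | h
      · exact absurd h.1 ha
      · exact (h j hj).2
    intro a ha b hb hab
    simp only [coe_filter, mem_univ, true_and, Set.mem_ofPred_eq] at ha hb
    exact le_antisymm (hmax b hb a (mem_part_comm.2 hab)) (hmax a ha b (mem_part_comm.2 hab.symm))
  have h2 := Finset.card_filter_add_card_filter_not (s := (univ : Finset (Fin n)))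
    (fun a => a < σ a)
  rw [Finset.card_univ, Fintype.card_fin] at h2
  omega

/-- The gap between consecutive points of a block contains no other point of that block; a different
block meeting the gap and also its outside would cross it. -/
theorem IsCyclicSuccessor.mem_Ioo {n : ℕ} {π : SetPartition n} {σ : Perm (Fin n)}
    (hσ : IsCyclicSuccessor π σ) (hπ : IsNonCrossing π) {a s t : Fin n}
    (hst : π.part s = π.part t) (hs : s ∈ Ioo a (σ a)) : t ∈ Ioo a (σ a) := by
  rw [Finset.mem_Ioo] at hs ⊢
  have hgap : ∀ j, π.part j = π.part a → ¬ (a < j ∧ j < σ a) := by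
    rintro j hj ⟨h1, h2⟩
    rcases (hσ a).2 with h | h
    · exact absurd (h.2 j (mem_part_comm.2 hj) h1) (not_le.2 h2)
    · exact absurd (h j (mem_part_comm.2 hj)).2 (not_le.2 h1)
  have hne : π.part s ≠ π.part a := fun h => hgap s h hs
  have hσa : π.part (σ a) = π.part a := mem_part_comm.1 (hσ a).1
  have hP : ∀ a, π.part a ∈ π.parts := fun a => π.part_mem.2 (mem_univ a)
  have ht1 : t ≠ a := by rintro rfl; exact hne hst
  have ht2 : t ≠ σ a := by rintro rfl; exact hne (hst.trans hσa)
  by_contra hcon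
  have : t < a ∨ σ a < t := by
    by_contra hc
    push Not at hc
    exact hcon ⟨lt_of_le_of_ne hc.1 ht1.symm, lt_of_le_of_ne hc.2 ht2⟩
  rcases this with h | h
  · exact hne (hπ (π.part s) (hP s) (π.part a) (hP a) t a s (σ a) h hs.1 hs.2
      (mem_part_comm.2 hst.symm) (self_mem_part π s) (self_mem_part π a) (hσ a).1)
  · exact hne (hπ (π.part a) (hP a) (π.part s) (hP s) a s (σ a) t hs.1 hs.2 h
      (self_mem_part π a) (hσ a).1 (self_mem_part π s) (mem_part_comm.2 hst.symm)).symm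

theorem finRotate_eq_ite {m : ℕ} (i : Fin (m + 1)) :
    finRotate (m + 1) i = if h : (i : ℕ) < m then ⟨i + 1, by omega⟩ else 0 := by
  split_ifs with h
  · exact finRotate_of_lt h
  · have : i = Fin.last m := Fin.ext (by have := i.2; simp; omega)
    rw [this, finRotate_last]

/-- Here `τ` is the Kreweras complement. The rotation carries `[a, σ a)` to `(a, σ a]`, and `σ⁻¹`
brings it back: it preserves the open gap and sends `σ a` to `a`. -/
theorem IsCyclicSuccessor.mem_Ico_iff {m : ℕ} {π : SetPartition (m + 1)}
    {σ τ : Perm (Fin (m + 1))} (hσ : IsCyclicSuccessor π σ) (hπ : IsNonCrossing π)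
    (hτ : σ * τ = finRotate (m + 1)) {a : Fin (m + 1)} (ha : a < σ a) (i : Fin (m + 1)) :
    τ i ∈ Ico a (σ a) ↔ i ∈ Ico a (σ a) := by
  have hpart : ∀ a, π.part (σ a) = π.part a := fun a => mem_part_comm.1 (hσ a).1
  have hsi : σ (τ i) = finRotate (m + 1) i := by rw [← hτ]; rfl
  have h1 : τ i ∈ Ico a (σ a) ↔ σ (τ i) ∈ Ioc a (σ a) := by
    have e1 : τ i ∈ Ico a (σ a) ↔ τ i = a ∨ τ i ∈ Ioo a (σ a) := by
      rw [← Finset.Ioo_insert_left ha, Finset.mem_insert]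
    have e2 : σ (τ i) ∈ Ioc a (σ a) ↔ σ (τ i) = σ a ∨ σ (τ i) ∈ Ioo a (σ a) := by
      rw [← Finset.Ioo_insert_right ha, Finset.mem_insert]
    rw [e1, e2, σ.injective.eq_iff]
    exact or_congr Iff.rfl ⟨hσ.mem_Ioo hπ (hpart _).symm, hσ.mem_Ioo hπ (hpart _)⟩
  rw [h1, hsi, finRotate_eq_ite, Finset.mem_Ioc, Finset.mem_Ico]
  split_ifs with h
  · rw [Fin.lt_def, Fin.le_def, Fin.le_def, Fin.lt_def]
    simp only
    omega
  · have h2 := (σ a).2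
    rw [Fin.lt_def, Fin.le_def, Fin.le_def, Fin.lt_def]
    simp only [Fin.val_zero]
    omega

theorem jointlyTransitive_of_mul_eq_finRotate {m : ℕ} {σ τ : Perm (Fin (m + 1))}
    (hτ : σ * τ = finRotate (m + 1)) : JointlyTransitive σ τ := by
  have hmem : finRotate (m + 1) ∈ Subgroup.closure {σ, τ} := by
    rw [← hτ]
    exact Subgroup.mul_mem _ (Subgroup.subset_closure (by simp)) (Subgroup.subset_closure (by simp))
  refine (MulAction.isPretransitive_iff_base (0 : Fin (m + 1))).2 fun b => ?_
  induction b using Fin.induction with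
  | zero => exact ⟨1, rfl⟩
  | succ i ih =>
    obtain ⟨g, hg⟩ := ih
    refine ⟨⟨_, hmem⟩ * g, ?_⟩
    rw [mul_smul, hg]
    change finRotate (m + 1) i.castSucc = i.succ
    rw [finRotate_eq_ite, dif_pos (by simp)]
    rfl

theorem cycleCount_finRotate (m : ℕ) : cycleCount (finRotate (m + 1)) = 1 := by
  rcases m with _ | m
  · rw [show finRotate (0 + 1) = 1 from by decide]
    simp [cycleCount, Perm.parts_partition]
  · rw [cycleCount, Perm.parts_partition, cycleType_finRotate, support_finRotate]
    simp

theorem IsCyclicSuccessor.cycleCount_add {m : ℕ} {π : SetPartition (m + 1)}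
    {σ τ : Perm (Fin (m + 1))} (hσ : IsCyclicSuccessor π σ) (hπ : IsNonCrossing π)
    (hτ : σ * τ = finRotate (m + 1)) : cycleCount σ + cycleCount τ = m + 2 := by
  have hle := cycleCount_add_le (jointlyTransitive_of_mul_eq_finRotate hτ)
  rw [Fintype.card_fin] at hle
  -- The upper bound is the genus inequality. For the lower bound, the ascents of `σ` together with
  -- the last point lie in distinct cycles of `τ`, separated by the `τ`-invariant intervals `[a, σ
  -- a)`.
  refine le_antisymm hle ?_
  have hcard := hσ.card_parts_le
  rw [cycleCount_eq_card_parts σ, hσ.cyclePartition_eq, cycleCount_eq_card_parts]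
  have hlast : Fin.last m ∉ univ.filter fun a => a < σ a := by
    simp only [mem_filter, mem_univ, true_and, not_lt]
    exact Fin.le_last _
  have hinj : (insert (Fin.last m) (univ.filter fun a => a < σ a)).card ≤
      (cyclePartition τ).parts.card := by
    refine Finset.card_le_card_of_injOn (cyclePartition τ).part
      (fun a _ => (cyclePartition τ).part_mem.2 (mem_univ a)) ?_
    have hinv : ∀ a, a < σ a → (fun i => if i ∈ Ico a (σ a) then (1 : ℝ) else 0) ∈
        invariantFunctions τ := by
      intro a ha i
      simp only [hσ.mem_Ico_iff hπ hτ ha i]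
    have hsep : ∀ a b, a < σ a → τ.SameCycle a b → b ∈ Ico a (σ a) := by
      intro a b ha hab
      by_contra hb
      have := eq_of_sameCycle (hinv a ha) hab
      rw [if_pos (Finset.mem_Ico.2 ⟨le_refl a, ha⟩), if_neg hb] at this
      exact one_ne_zero this
    intro a ha b hb hab
    have hab' : τ.SameCycle a b := by
      rw [← mem_part_cyclePartition, mem_part_comm, hab]
    simp only [coe_insert, coe_filter, mem_univ, true_and, Set.mem_insert_iff,
      Set.mem_ofPred_eq] at ha hb
    rcases ha with rfl | ha <;> rcases hb with rfl | hb
    · rfl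
    · exact absurd (Finset.mem_Ico.1 (hsep _ _ hb hab'.symm)).2 (not_lt.2 (Fin.le_last _))
    · exact absurd (Finset.mem_Ico.1 (hsep _ _ ha hab')).2 (not_lt.2 (Fin.le_last _))
    · exact le_antisymm (Finset.mem_Ico.1 (hsep _ _ ha hab')).1
        (Finset.mem_Ico.1 (hsep _ _ hb hab'.symm)).1
  rw [Finset.card_insert_of_notMem hlast] at hinj
  omega

/-- In genus zero the indicator of `a` splits as `g + h` with `g` invariant under `σ` and `h` under
`τ`. The increments of `h` along the rotation are then forced, so telescoping from `0` gives `h`,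
and hence `g`, explicitly up to a constant. The function obtained is `-1` on `(a, σ a)` if `a < σ
a`, and `1` on `[σ a, a]` otherwise, and `0` elsewhere; its invariance says that no cycle straddles
this interval. -/
theorem interval_mem_invariantFunctions {m : ℕ} {σ τ : Perm (Fin (m + 1))}
    (hτ : σ * τ = finRotate (m + 1)) (hc : cycleCount σ + cycleCount τ = m + 2)
    (a : Fin (m + 1)) :
    (fun j => (if σ a ≤ j then (1 : ℝ) else 0) - if a < j then 1 else 0) ∈
      invariantFunctions σ := by
  have htop := sup_invariantFunctions_eq_top (jointlyTransitive_of_mul_eq_finRotate hτ)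
    (by rw [Fintype.card_fin]; exact hc)
  obtain ⟨g, hg, h, hh, hgh⟩ := Submodule.mem_sup.1
    (show (fun j => if j = a then (1 : ℝ) else 0) ∈ invariantFunctions σ ⊔ invariantFunctions τ by
      rw [htop]; trivial)
  have hgh' : ∀ j, g j + h j = if j = a then (1 : ℝ) else 0 := fun j => congrFun hgh j
  have hstep : ∀ i, h (finRotate (m + 1) i) - h i =
      (if finRotate (m + 1) i = a then (1 : ℝ) else 0) -
        if finRotate (m + 1) i = σ a then 1 else 0 := by
    intro i
    have h1 := hgh' (finRotate (m + 1) i)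
    have h2 := hgh' (τ i)
    rw [hh i] at h2
    have h3 : g (finRotate (m + 1) i) = g (τ i) := by rw [← hτ]; exact hg (τ i)
    have h4 : τ i = a ↔ finRotate (m + 1) i = σ a := by
      rw [← hτ, Perm.mul_apply, σ.injective.eq_iff]
    simp only [h4] at h2
    linarith
  have hsum : ∀ j, h j = (h 0 - (if (0 : Fin (m + 1)) = a then 1 else 0) +
      if (0 : Fin (m + 1)) = σ a then 1 else 0) +
      ((if a ≤ j then (1 : ℝ) else 0) - if σ a ≤ j then 1 else 0) := by
    intro j
    induction j using Fin.induction with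
    | zero =>
      have e : ∀ b : Fin (m + 1), b ≤ 0 ↔ 0 = b := fun b => by
        rw [Fin.le_zero_iff, eq_comm]
      simp only [e]
      ring
    | succ i ih =>
      have hr : finRotate (m + 1) i.castSucc = i.succ := by
        rw [finRotate_eq_ite, dif_pos (by simp)]
        rfl
      have h1 := hstep i.castSucc
      rw [hr] at h1
      have e : ∀ b : Fin (m + 1), (if b ≤ i.succ then (1 : ℝ) else 0) =
          (if b ≤ i.castSucc then 1 else 0) + if i.succ = b then 1 else 0 := by
        intro b
        by_cases hb : i.succ = b
        · have h5 : ¬ b ≤ i.castSucc := by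
            rw [← hb, not_le]; exact Fin.castSucc_lt_succ
          rw [if_pos hb, if_neg h5, if_pos hb.ge, zero_add]
        · rw [if_neg hb, add_zero]
          have : b ≤ i.succ ↔ b ≤ i.castSucc := by
            have hb' : (i : ℕ) + 1 ≠ b := fun h => hb (Fin.ext (by simpa using h))
            rw [Fin.le_def, Fin.le_def]
            simp only [Fin.val_succ, Fin.val_castSucc]
            omega
          simp only [this]
      rw [e, e]
      linarith
  have hform : ∀ j, g j = ((if σ a ≤ j then (1 : ℝ) else 0) - if a < j then 1 else 0) -
      (h 0 - (if (0 : Fin (m + 1)) = a then 1 else 0) +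
      if (0 : Fin (m + 1)) = σ a then 1 else 0) := by
    intro j
    have h1 := hgh' j
    rw [hsum j] at h1
    have e : (if a ≤ j then (1 : ℝ) else 0) =
        (if j = a then 1 else 0) + if a < j then 1 else 0 := by
      rcases lt_trichotomy a j with hj | hj | hj
      · simp [hj, hj.le, hj.ne']
      · simp [hj]
      · simp [not_le.2 hj, not_lt.2 hj.le, hj.ne]
    rw [e] at h1
    linarith
  intro j
  have := hg j
  rw [hform, hform] at this
  simpa using this

theorem isCyclicSuccessor_cyclePartition {m : ℕ} {σ τ : Perm (Fin (m + 1))}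
    (hτ : σ * τ = finRotate (m + 1)) (hc : cycleCount σ + cycleCount τ = m + 2) :
    IsCyclicSuccessor (cyclePartition σ) σ := by
  intro a
  refine ⟨mem_part_cyclePartition.2 (Perm.sameCycle_apply_right.2 (Perm.SameCycle.refl _ _)), ?_⟩
  have hinv := interval_mem_invariantFunctions hτ hc a
  rcases lt_or_ge a (σ a) with h | h
  · refine Or.inl ⟨h, fun j hj haj => ?_⟩
    have := eq_of_sameCycle hinv (mem_part_cyclePartition.1 hj)
    by_contra hlt
    rw [if_neg (not_le.2 h), if_neg (lt_irrefl a), if_neg hlt, if_pos haj] at this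
    norm_num at this
  · refine Or.inr fun j hj => ?_
    have := eq_of_sameCycle hinv (mem_part_cyclePartition.1 hj)
    rw [if_pos h, if_neg (lt_irrefl a)] at this
    by_contra hcon
    rw [not_and_or, not_le, not_le] at hcon
    rcases hcon with h1 | h1
    · rw [if_neg (not_le.2 h1), if_neg (not_lt.2 (h1.le.trans h))] at this
      norm_num at this
    · rw [if_pos (h.trans h1.le), if_pos h1] at this
      norm_num at this

theorem isNonCrossing_cyclePartition {m : ℕ} {σ τ : Perm (Fin (m + 1))}
    (hτ : σ * τ = finRotate (m + 1)) (hc : cycleCount σ + cycleCount τ = m + 2) :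
    IsNonCrossing (cyclePartition σ) := by
  intro V hV W hW a b c e hab hbc hce haV hcV hbW heW
  by_contra hne
  have hσ := isCyclicSuccessor_cyclePartition hτ hc
  -- With `x` the last point of `V` before `b`, the gap `(x, σ x)` contains `b` but not `e`, against
  -- the invariance of its indicator on the cycle `W`.
  obtain ⟨x, hxm, hxmax⟩ : ∃ x, (x ∈ V ∧ x < b) ∧ ∀ y ∈ V, y < b → y ≤ x := by
    have hne' : (V.filter (· < b)).Nonempty := ⟨a, Finset.mem_filter.2 ⟨haV, hab⟩⟩
    have hmax := Finset.max'_mem _ hne'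
    rw [Finset.mem_filter] at hmax
    exact ⟨_, hmax, fun y hy hyb => Finset.le_max' _ _ (Finset.mem_filter.2 ⟨hy, hyb⟩)⟩
  have hxV : (cyclePartition σ).part x = V := Finpartition.part_eq_of_mem _ hV hxm.1
  have hbW' : (cyclePartition σ).part b = W := Finpartition.part_eq_of_mem _ hW hbW
  obtain ⟨h1, h2⟩ := hσ x
  rw [hxV] at h1 h2
  rcases h2 with ⟨h2, h3⟩ | h2
  · have h4 : σ x ≤ c := h3 c hcV (hxm.2.trans hbc)
    have h5 : b < σ x := by
      by_contra hlt
      have hne2 : σ x ≠ b := by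
        rintro heq
        rw [heq] at h1
        exact hne (Finpartition.eq_of_mem_parts _ hV hW h1 hbW)
      exact absurd (hxmax _ h1 (lt_of_le_of_ne (not_lt.1 hlt) hne2)) (not_le.2 h2)
    have hbe : σ.SameCycle b e := mem_part_cyclePartition.1 (by rw [hbW']; exact heW)
    have := eq_of_sameCycle (interval_mem_invariantFunctions hτ hc x) hbe
    rw [if_neg (not_le.2 h5), if_pos hxm.2, if_pos (h4.trans hce.le),
      if_pos (hxm.2.trans (hbc.trans hce))] at this
    norm_num at this
  · exact absurd (h2 c hcV).2 (not_le.2 (hxm.2.trans hbc))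

theorem mem_NC {n : ℕ} {π : SetPartition n} : π ∈ NC n ↔ IsNonCrossing π := by
  simp [NC]

/-- Biane's bijection: the permutations of genus zero relative to a full cycle are the
non-crossing partitions. -/
theorem sum_genus_zero_eq_sum_NC (u : ℕ → ℝ) (m : ℕ) :
    ∑ σ : Perm (Fin (m + 1)) with
        cycleCount σ + cycleCount (σ⁻¹ * finRotate (m + 1)) = m + 2, cycleWeight u σ =
      ∑ π ∈ NC (m + 1), blockProd u π := by
  have hmul : ∀ σ : Perm (Fin (m + 1)), σ * (σ⁻¹ * finRotate (m + 1)) = finRotate (m + 1) :=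
    fun σ => by rw [mul_inv_cancel_left]
  refine Finset.sum_bij (fun σ _ => cyclePartition σ) ?_ ?_ ?_ ?_
  · intro σ hσ
    rw [Finset.mem_filter] at hσ
    exact mem_NC.2 (isNonCrossing_cyclePartition (hmul σ) hσ.2)
  · intro σ hσ τ hτ h
    rw [Finset.mem_filter] at hσ hτ
    have h1 := isCyclicSuccessor_cyclePartition (hmul σ) hσ.2
    have h2 := isCyclicSuccessor_cyclePartition (hmul τ) hτ.2
    rw [← h] at h2
    exact h1.unique h2
  · intro π hπ
    rw [mem_NC] at hπ
    obtain ⟨σ, hσ⟩ := exists_isCyclicSuccessor π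
    exact ⟨σ, Finset.mem_filter.2 ⟨mem_univ _, hσ.cycleCount_add hπ (hmul σ)⟩,
      hσ.cyclePartition_eq⟩
  · intro σ _
    exact cycleWeight_eq_prod u σ

end NonCrossing

/-! ### Pairs of permutations decomposed by the orbit of a point. -/

section PairSums

set_option linter.unusedSectionVars false

open Equiv Finset

/-- The sum of `x_σ y_τ` over all pairs of permutations. -/
def totalPairSum (α : Type*) [Fintype α] [DecidableEq α] (x y : ℕ → ℝ) : ℝ :=
  ∑ p : Perm α × Perm α, cycleWeight x p.1 * cycleWeight y p.2

open Classical in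
/-- The sum of `x_σ y_τ` over the pairs of permutations that generate a transitive group. -/
def transitivePairSum (α : Type*) [Fintype α] [DecidableEq α] (x y : ℕ → ℝ) : ℝ :=
  ∑ p : Perm α × Perm α with JointlyTransitive p.1 p.2, cycleWeight x p.1 * cycleWeight y p.2

variable {α β : Type*} [Fintype α] [DecidableEq α] [Fintype β] [DecidableEq β]

theorem totalPairSum_congr (e : α ≃ β) (x y : ℕ → ℝ) :
    totalPairSum α x y = totalPairSum β x y := by
  refine Fintype.sum_equiv (e.permCongr.prodCongr e.permCongr) _ _ fun p => ?_
  simp only [prodCongr_apply, Prod.map_fst, Prod.map_snd, cycleWeight_permCongr]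

theorem JointlyTransitive.permCongr {σ τ : Perm α} (e : α ≃ β) (h : JointlyTransitive σ τ) :
    JointlyTransitive (e.permCongr σ) (e.permCongr τ) := by
  have key : ∀ g ∈ Subgroup.closure {σ, τ},
      e.permCongr g ∈ Subgroup.closure {e.permCongr σ, e.permCongr τ} := by
    intro g hg
    change e.permCongrHom g ∈ _
    have := Subgroup.mem_map_of_mem e.permCongrHom.toMonoidHom hg
    rw [MonoidHom.map_closure, Set.image_pair] at this
    exact this
  refine ⟨fun a b => ?_⟩
  obtain ⟨⟨g, hg⟩, hgab⟩ := h.exists_smul_eq (e.symm a) (e.symm b)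
  refine ⟨⟨_, key g hg⟩, ?_⟩
  change e.permCongr g a = b
  rw [permCongr_apply]
  exact (congrArg e hgab).trans (e.apply_symm_apply b)

theorem transitivePairSum_congr (e : α ≃ β) (x y : ℕ → ℝ) :
    transitivePairSum α x y = transitivePairSum β x y := by
  classical
  refine Finset.sum_equiv (e.permCongr.prodCongr e.permCongr) (fun p => ?_) fun p _ => ?_
  · simp only [mem_filter, mem_univ, true_and, prodCongr_apply, Prod.map_fst, Prod.map_snd]
    refine ⟨fun h => h.permCongr e, fun h => ?_⟩
    have := h.permCongr e.symm
    rwa [show e.symm.permCongr (e.permCongr p.1) = p.1 by ext; simp,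
      show e.symm.permCongr (e.permCongr p.2) = p.2 by ext; simp] at this
  · simp only [prodCongr_apply, Prod.map_fst, Prod.map_snd, cycleWeight_permCongr]

open Classical in
/-- The orbit of a point under the group generated by two permutations. -/
def pairOrbit (a : α) (p : Perm α × Perm α) : Finset α :=
  univ.filter fun b => ∃ g ∈ Subgroup.closure {p.1, p.2}, g a = b

theorem mem_pairOrbit {a b : α} {p : Perm α × Perm α} :
    b ∈ pairOrbit a p ↔ ∃ g ∈ Subgroup.closure {p.1, p.2}, g a = b := by
  simp [pairOrbit]

theorem self_mem_pairOrbit (a : α) (p : Perm α × Perm α) : a ∈ pairOrbit a p :=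
  mem_pairOrbit.2 ⟨1, Subgroup.one_mem _, rfl⟩

theorem apply_mem_pairOrbit_iff {a : α} {p : Perm α × Perm α} {g : Perm α}
    (hg : g ∈ Subgroup.closure {p.1, p.2}) (b : α) :
    g b ∈ pairOrbit a p ↔ b ∈ pairOrbit a p := by
  simp only [mem_pairOrbit]
  constructor
  · rintro ⟨k, hk, h⟩
    exact ⟨g⁻¹ * k, Subgroup.mul_mem _ (Subgroup.inv_mem _ hg) hk, by simp [h]⟩
  · rintro ⟨k, hk, h⟩
    exact ⟨g * k, Subgroup.mul_mem _ hg hk, by simp [h]⟩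

/-- A map intertwining the generators intertwines words in them. It is applied to the inclusion of
an invariant subset and to conjugation. -/
theorem exists_mem_closure_of_agree {γ δ : Type*} (f : γ → δ)
    {σ τ : Perm γ} {σ' τ' : Perm δ} (hσ : ∀ c, f (σ c) = σ' (f c)) (hτ : ∀ c, f (τ c) = τ' (f c)) :
    (∀ g ∈ Subgroup.closure {σ, τ}, ∃ g' ∈ Subgroup.closure {σ', τ'}, ∀ c, f (g c) = g' (f c)) ∧
    (∀ g' ∈ Subgroup.closure {σ', τ'}, ∃ g ∈ Subgroup.closure {σ, τ},
      ∀ c, f (g c) = g' (f c)) := by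
  have hinv : ∀ (g : Perm γ) (g' : Perm δ), (∀ c, f (g c) = g' (f c)) →
      ∀ c, f (g⁻¹ c) = g'⁻¹ (f c) := by
    intro g g' h c
    rw [Perm.eq_inv_iff_eq, ← h]
    simp
  constructor
  · intro g hg
    induction hg using Subgroup.closure_induction with
    | mem x hx =>
      rcases hx with rfl | rfl
      · exact ⟨σ', Subgroup.subset_closure (by simp), hσ⟩
      · exact ⟨τ', Subgroup.subset_closure (by simp), hτ⟩
    | one => exact ⟨1, Subgroup.one_mem _, fun _ => rfl⟩
    | mul x y _ _ hx hy =>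
      obtain ⟨x', hx', h1⟩ := hx
      obtain ⟨y', hy', h2⟩ := hy
      exact ⟨x' * y', Subgroup.mul_mem _ hx' hy', fun c => by
        rw [Perm.mul_apply, Perm.mul_apply, h1, h2]⟩
    | inv x _ hx =>
      obtain ⟨x', hx', h1⟩ := hx
      exact ⟨x'⁻¹, Subgroup.inv_mem _ hx', hinv _ _ h1⟩
  · intro g hg
    induction hg using Subgroup.closure_induction with
    | mem x hx =>
      rcases hx with rfl | rfl
      · exact ⟨σ, Subgroup.subset_closure (by simp), hσ⟩
      · exact ⟨τ, Subgroup.subset_closure (by simp), hτ⟩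
    | one => exact ⟨1, Subgroup.one_mem _, fun _ => rfl⟩
    | mul x y _ _ hx hy =>
      obtain ⟨x', hx', h1⟩ := hx
      obtain ⟨y', hy', h2⟩ := hy
      exact ⟨x' * y', Subgroup.mul_mem _ hx' hy', fun c => by
        rw [Perm.mul_apply, Perm.mul_apply, h1, h2]⟩
    | inv x _ hx =>
      obtain ⟨x', hx', h1⟩ := hx
      exact ⟨x'⁻¹, Subgroup.inv_mem _ hx', hinv _ _ h1⟩

/-- Glue pairs of permutations of a set and of its complement. -/
def gluePair (B : Finset α)
    (q : (Perm {b // b ∈ B} × Perm {b // b ∈ B}) × (Perm {b // b ∉ B} × Perm {b // b ∉ B})) :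
    Perm α × Perm α :=
  (Perm.subtypeCongr q.1.1 q.2.1, Perm.subtypeCongr q.1.2 q.2.2)

theorem pairOrbit_gluePair_eq_iff {B : Finset α} {a : α} (ha : a ∈ B)
    (q : (Perm {b // b ∈ B} × Perm {b // b ∈ B}) × (Perm {b // b ∉ B} × Perm {b // b ∉ B})) :
    pairOrbit a (gluePair B q) = B ↔ JointlyTransitive q.1.1 q.1.2 := by
  have hagree := exists_mem_closure_of_agree (Subtype.val : {b // b ∈ B} → α)
    (σ := q.1.1) (τ := q.1.2) (σ' := (gluePair B q).1)
    (τ' := (gluePair B q).2)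
    (fun c => (Perm.subtypeCongr.left_apply_subtype _ _ c).symm)
    (fun c => (Perm.subtypeCongr.left_apply_subtype _ _ c).symm)
  have horb : ∀ c, c ∈ pairOrbit a (gluePair B q) ↔
      ∃ g ∈ Subgroup.closure {q.1.1, q.1.2}, (g ⟨a, ha⟩ : α) = c := by
    intro c
    rw [mem_pairOrbit]
    constructor
    · rintro ⟨g', hg', rfl⟩
      obtain ⟨g, hg, h⟩ := hagree.2 g' hg'
      exact ⟨g, hg, h _⟩
    · rintro ⟨g, hg, rfl⟩
      obtain ⟨g', hg', h⟩ := hagree.1 g hg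
      exact ⟨g', hg', (h ⟨a, ha⟩).symm⟩
  rw [JointlyTransitive, MulAction.isPretransitive_iff_base (⟨a, ha⟩ : {b // b ∈ B})]
  constructor
  · intro h b
    obtain ⟨g, hg, hgb⟩ := (horb b).1 (by rw [h]; exact b.2)
    exact ⟨⟨g, hg⟩, Subtype.ext hgb⟩
  · intro h
    ext c
    rw [horb]
    constructor
    · rintro ⟨g, -, rfl⟩
      exact (g ⟨a, ha⟩).2
    · intro hc
      obtain ⟨⟨g, hg⟩, hgc⟩ := h ⟨c, hc⟩
      exact ⟨g, hg, congrArg Subtype.val hgc⟩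

theorem subtypeCongr_injective {p : α → Prop} [DecidablePred p]
    {σ σ' : Perm {a // p a}} {τ τ' : Perm {a // ¬p a}}
    (h : Perm.subtypeCongr σ τ = Perm.subtypeCongr σ' τ') : σ = σ' ∧ τ = τ' := by
  have := Perm.subtypeCongrHom_injective p (a₁ := (σ, τ)) (a₂ := (σ', τ')) h
  exact Prod.ext_iff.1 this

theorem exists_subtypeCongr_eq {p : α → Prop} [DecidablePred p] {g : Perm α}
    (h : ∀ a, p (g a) ↔ p a) :
    ∃ (σ : Perm {a // p a}) (τ : Perm {a // ¬p a}), Perm.subtypeCongr σ τ = g := by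
  refine ⟨g.subtypePerm h, g.subtypePerm (fun a => not_congr (h a)), ?_⟩
  ext a
  by_cases ha : p a
  · rw [Perm.subtypeCongr.left_apply _ _ ha]; rfl
  · rw [Perm.subtypeCongr.right_apply _ _ ha]; rfl

/-- Once the orbit is `B`, the pair restricts to a transitive pair on `B` and an arbitrary pair on
the complement, and weights multiply under gluing. -/
theorem sum_pairOrbit_eq (B : Finset α) {a : α} (ha : a ∈ B) (x y : ℕ → ℝ) :
    ∑ p : Perm α × Perm α with pairOrbit a p = B, cycleWeight x p.1 * cycleWeight y p.2 =
      transitivePairSum {b // b ∈ B} x y * totalPairSum {b // b ∉ B} x y := by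
  classical
  rw [transitivePairSum, totalPairSum, Finset.sum_mul_sum, ← Finset.sum_product']
  symm
  refine Finset.sum_bij (fun q _ => gluePair B q) ?_ ?_ ?_ ?_
  · intro q hq
    simp only [mem_product, mem_filter, mem_univ, true_and, and_true] at hq
    simp only [mem_filter, mem_univ, true_and]
    exact (pairOrbit_gluePair_eq_iff ha q).2 hq
  · rintro ⟨⟨q1, q2⟩, q3, q4⟩ - ⟨⟨q1', q2'⟩, q3', q4'⟩ - h
    obtain ⟨h1, h2⟩ := Prod.ext_iff.1 h
    obtain ⟨rfl, rfl⟩ := subtypeCongr_injective h1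
    obtain ⟨rfl, rfl⟩ := subtypeCongr_injective h2
    rfl
  · rintro ⟨σ, τ⟩ hp
    simp only [mem_filter, mem_univ, true_and] at hp
    obtain ⟨q1, q3, h1⟩ := exists_subtypeCongr_eq (p := (· ∈ B)) (g := σ) fun c => by
      rw [← hp]; exact apply_mem_pairOrbit_iff (Subgroup.subset_closure (by simp)) c
    obtain ⟨q2, q4, h2⟩ := exists_subtypeCongr_eq (p := (· ∈ B)) (g := τ) fun c => by
      rw [← hp]; exact apply_mem_pairOrbit_iff (Subgroup.subset_closure (by simp)) c
    have hg : gluePair B ((q1, q2), (q3, q4)) = (σ, τ) := Prod.ext h1 h2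
    refine ⟨((q1, q2), (q3, q4)), ?_, hg⟩
    simp only [mem_product, mem_filter, mem_univ, true_and, and_true]
    exact (pairOrbit_gluePair_eq_iff ha ((q1, q2), (q3, q4))).1 (by rw [hg]; exact hp)
  · rintro ⟨⟨q1, q2⟩, q3, q4⟩ -
    simp only [gluePair]
    rw [cycleWeight_subtypeCongr, cycleWeight_subtypeCongr]
    ring

theorem totalPairSum_eq_sum_orbit (a : α) (x y : ℕ → ℝ) :
    totalPairSum α x y = ∑ B ∈ (univ.erase a).powerset,
      transitivePairSum {b // b ∈ insert a B} x y * totalPairSum {b // b ∉ insert a B} x y := by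
  classical
  rw [totalPairSum, ← Finset.sum_fiberwise univ (pairOrbit a),
    ← Finset.sum_filter_of_ne (p := fun B => a ∈ B)]
  · symm
    refine Finset.sum_bij (fun B _ => insert a B) ?_ ?_ ?_ ?_
    · intro B _
      simp
    · intro B hB C hC h
      have hB' : a ∉ B := fun h => by simpa using Finset.mem_powerset.1 hB h
      have hC' : a ∉ C := fun h => by simpa using Finset.mem_powerset.1 hC h
      rw [← Finset.erase_insert hB', h, Finset.erase_insert hC']
    · intro B hB
      refine ⟨B.erase a, ?_, Finset.insert_erase (Finset.mem_filter.1 hB).2⟩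
      exact Finset.mem_powerset.2 (Finset.erase_subset_erase _ (subset_univ _))
    · intro B _
      exact (sum_pairOrbit_eq _ (mem_insert_self a B) x y).symm
  · intro B _ hB
    by_contra ha
    refine hB (Finset.sum_eq_zero fun p hp => absurd ?_ ha)
    rw [← (Finset.mem_filter.1 hp).2]
    exact self_mem_pairOrbit a p

/-- The orbit decomposition of pairs of permutations. -/
theorem totalPairSum_succ (n : ℕ) (x y : ℕ → ℝ) :
    totalPairSum (Fin (n + 1)) x y = ∑ k ∈ range (n + 1),
      (n.choose k : ℝ) * (transitivePairSum (Fin (k + 1)) x y *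
        totalPairSum (Fin (n - k)) x y) := by
  rw [totalPairSum_eq_sum_orbit 0]
  have hcard : (univ.erase (0 : Fin (n + 1))).card = n := by simp
  have := Finset.sum_powerset_apply_card (x := univ.erase (0 : Fin (n + 1)))
    (fun k => transitivePairSum (Fin (k + 1)) x y *
        totalPairSum (Fin (n - k)) x y)
  rw [hcard] at this
  simp only [nsmul_eq_mul] at this
  rw [← this]
  refine Finset.sum_congr rfl fun B hB => ?_
  have hB' : (0 : Fin (n + 1)) ∉ B := fun h => by simpa using Finset.mem_powerset.1 hB h
  have h2 : Fintype.card {b // b ∉ insert 0 B} = n - B.card := by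
    rw [Fintype.card_of_subtype (univ \ insert 0 B) (by simp), Finset.card_univ_sdiff,
      Finset.card_insert_of_notMem hB', Fintype.card_fin]
    omega
  have e1 := Finset.equivFinOfCardEq (Finset.card_insert_of_notMem hB')
  have e2 := Fintype.equivFinOfCardEq h2
  rw [← transitivePairSum_congr e1, ← totalPairSum_congr e2]

theorem totalPairSum_zero (x y : ℕ → ℝ) : totalPairSum (Fin 0) x y = 1 := by
  simp [totalPairSum, cycleWeight, Perm.parts_partition, Subsingleton.elim _ (1 : Perm (Fin 0))]

end PairSums

/-! ### Möbius inversion over set partitions through a formal logarithm. -/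

section SetPartitions

open Finset

theorem sum_finpartition_insert {α : Type*} [DecidableEq α] {s : Finset α} {x : α}
    (hx : x ∉ s) (F : Finset (Finset α) → ℝ) :
    ∑ π : Finpartition (insert x s), F π.parts =
      ∑ B ∈ s.powerset, ∑ π : Finpartition (s \ B), F (insert (insert x B) π.parts) := by
  have hsup : ∀ B ∈ s.powerset, s \ B ⊔ insert x B = insert x s := by
    intro B hB
    rw [Finset.mem_powerset] at hB
    ext y
    simp only [sup_eq_union, mem_union, Finset.mem_sdiff, mem_insert]
    have := @hB y
    tauto
  have hdisj : ∀ B : Finset α, Disjoint (s \ B) (insert x B) := by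
    intro B
    rw [Finset.disjoint_left]
    intro y hy hy'
    rw [Finset.mem_sdiff] at hy
    rw [Finset.mem_insert] at hy'
    rcases hy' with rfl | hy'
    · exact hx hy.1
    · exact hy.2 hy'
  have hnot : ∀ (B : Finset α) (π : Finpartition (s \ B)) V, x ∈ V → V ∉ π.parts := by
    intro B π V hV hVπ
    exact hx (Finset.mem_sdiff.1 (π.le hVπ hV)).1
  rw [Finset.sum_sigma']
  symm
  -- A partition of `insert x s` is the block of `x`, that is `insert x B`, together with a
  -- partition of `s \ B`.
  refine Finset.sum_bij (fun p hp => p.2.extend (b := insert x p.1)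
    (Finset.insert_nonempty _ _).ne_empty (hdisj p.1) (hsup p.1 (Finset.mem_sigma.1 hp).1)) ?_ ?_ ?_ ?_
  · intro _ _
    exact mem_univ _
  · rintro ⟨B, π⟩ hB ⟨C, ρ⟩ hC h
    have hB' : x ∉ B := fun h => hx (Finset.mem_powerset.1 (Finset.mem_sigma.1 hB).1 h)
    have hC' : x ∉ C := fun h => hx (Finset.mem_powerset.1 (Finset.mem_sigma.1 hC).1 h)
    have h' : insert (insert x B) π.parts = insert (insert x C) ρ.parts :=
      congrArg Finpartition.parts h
    have hBC : insert x B = insert x C := by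
      have h1 : insert x B ∈ insert (insert x C) ρ.parts := by
        rw [← h']; exact mem_insert_self _ _
      rcases Finset.mem_insert.1 h1 with h1 | h1
      · exact h1
      · exact absurd h1 (hnot C ρ _ (mem_insert_self _ _))
    have hBC' : B = C := by
      rw [← Finset.erase_insert hB', hBC, Finset.erase_insert hC']
    subst hBC'
    have h2 : π.parts = ρ.parts := by
      rw [← Finset.erase_insert (hnot B π _ (mem_insert_self x B)), h',
        Finset.erase_insert (hnot B ρ _ (mem_insert_self x B))]
    rw [Finpartition.ext h2]
  · intro π _
    have hxs : x ∈ insert x s := mem_insert_self x s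
    have hpart : x ∈ π.part x := π.mem_part_self.2 hxs
    have hpm : π.part x ∈ π.parts := π.part_mem.2 hxs
    have hins : insert x ((π.part x).erase x) = π.part x := Finset.insert_erase hpart
    have hsupE : (π.parts.erase (π.part x)).sup id = s \ (π.part x).erase x := by
      ext y
      rw [Finset.mem_sup]
      simp only [mem_erase, id, Finset.mem_sdiff]
      constructor
      · rintro ⟨V, ⟨hne, hV⟩, hy⟩
        have hyx : y ∉ π.part x := fun h => hne (π.eq_of_mem_parts hV hpm hy h)
        have h1 := Finset.mem_insert.1 (π.le hV hy)
        refine ⟨h1.resolve_left ?_, fun h => hyx h.2⟩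
        rintro rfl
        exact hyx hpart
      · rintro ⟨hys, hn⟩
        obtain ⟨V, hV, hyV⟩ := π.exists_mem (Finset.mem_insert_of_mem (b := x) hys)
        refine ⟨V, ⟨?_, hV⟩, hyV⟩
        rintro rfl
        exact hn ⟨fun h => hx (h ▸ hys), hyV⟩
    refine ⟨⟨(π.part x).erase x, π.ofSubset (Finset.erase_subset _ _) hsupE⟩, ?_, ?_⟩
    · refine Finset.mem_sigma.2 ⟨Finset.mem_powerset.2 fun y hy => ?_, mem_univ _⟩
      have h1 := Finset.mem_insert.1 (π.part_subset x (Finset.mem_of_mem_erase hy))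
      exact h1.resolve_left (Finset.ne_of_mem_erase hy)
    · ext1
      change insert (insert x ((π.part x).erase x)) (π.parts.erase (π.part x)) = π.parts
      rw [hins, Finset.insert_erase hpm]
  · intro _ _
    rfl

/-- The exponential generating function of `a` without its constant term. -/
def reducedEGF (a : ℕ → ℝ) : PowerSeries ℝ :=
  PowerSeries.mk fun k => if k = 0 then 0 else a k / (k.factorial : ℝ)

theorem coeff_derivative_reducedEGF (a : ℕ → ℝ) (n : ℕ) :
    PowerSeries.coeff n (PowerSeries.derivative ℝ (reducedEGF a)) =
      a (n + 1) / (n.factorial : ℝ) := by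
  rw [PowerSeries.coeff_derivative, reducedEGF,
    PowerSeries.coeff_mk,
    if_neg (Nat.succ_ne_zero n), Nat.factorial_succ]
  have : (n.factorial : ℝ) ≠ 0 := by positivity
  have : (n : ℝ) + 1 ≠ 0 := by positivity
  push_cast
  field_simp

theorem X_dvd_reducedEGF (a : ℕ → ℝ) : PowerSeries.X ∣ reducedEGF a := by
  rw [PowerSeries.X_dvd_iff, ← PowerSeries.coeff_zero_eq_constantCoeff_apply, reducedEGF,
    PowerSeries.coeff_mk, if_pos rfl]

theorem coeff_reducedEGF_pow_of_lt (a : ℕ → ℝ) {n m : ℕ} (h : n < m) (f : PowerSeries ℝ) :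
    PowerSeries.coeff n (f * reducedEGF a ^ m) = 0 :=
  PowerSeries.X_pow_dvd_iff.1 ((pow_dvd_pow_of_dvd (X_dvd_reducedEGF a) m).mul_left f) n h

/-- `n!` times the `n`-th coefficient of `(A - 1)^m / m!`. -/
def partitionCoeff (a : ℕ → ℝ) (n m : ℕ) : ℝ :=
  (n.factorial : ℝ) / (m.factorial : ℝ) * PowerSeries.coeff n (reducedEGF a ^ m)

/-- Differentiating the power `(A - 1)^(m+1)` marks one factor, which is the generating-function
form of singling out the block of a given point. -/
theorem partitionCoeff_succ (a : ℕ → ℝ) (n m : ℕ) :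
    partitionCoeff a (n + 1) (m + 1) =
      ∑ k ∈ range (n + 1), (n.choose k : ℝ) * (a (k + 1) * partitionCoeff a (n - k) m) := by
  have h1 : ((n : ℝ) + 1) * PowerSeries.coeff (n + 1) (reducedEGF a ^ (m + 1)) =
      ((m : ℝ) + 1) * ∑ k ∈ range (n + 1), a (k + 1) / (k.factorial : ℝ) *
        PowerSeries.coeff (n - k) (reducedEGF a ^ m) := by
    have h := PowerSeries.coeff_derivative (reducedEGF a ^ (m + 1)) n
    rw [PowerSeries.derivative_pow, Nat.add_sub_cancel,
      show (((m + 1 : ℕ) : PowerSeries ℝ) * reducedEGF a ^ m) *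
        PowerSeries.derivative ℝ (reducedEGF a) = ((m + 1 : ℕ) : PowerSeries ℝ) *
        (PowerSeries.derivative ℝ (reducedEGF a) * reducedEGF a ^ m) by ring,
      show ((m + 1 : ℕ) : PowerSeries ℝ) = PowerSeries.C ((m : ℝ) + 1) by push_cast; simp,
      PowerSeries.coeff_C_mul, PowerSeries.coeff_mul,
      Finset.Nat.sum_antidiagonal_eq_sum_range_succ_mk] at h
    simp only [coeff_derivative_reducedEGF] at h
    rw [mul_comm, ← h]
  have hn : (n : ℝ) + 1 ≠ 0 := by positivity
  have hm : (m : ℝ) + 1 ≠ 0 := by positivity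
  have hm' : (m.factorial : ℝ) ≠ 0 := by positivity
  have h2 : partitionCoeff a (n + 1) (m + 1) = (n.factorial : ℝ) / (m.factorial : ℝ) *
      ∑ k ∈ range (n + 1), a (k + 1) / (k.factorial : ℝ) *
        PowerSeries.coeff (n - k) (reducedEGF a ^ m) := by
    rw [partitionCoeff, Nat.factorial_succ, Nat.factorial_succ]
    set S := ∑ k ∈ range (n + 1), a (k + 1) / (k.factorial : ℝ) *
        PowerSeries.coeff (n - k) (reducedEGF a ^ m)
    push_cast
    field_simp
    linear_combination h1
  rw [h2, Finset.mul_sum]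
  refine Finset.sum_congr rfl fun k hk => ?_
  have hk' : k ≤ n := Nat.lt_succ_iff.1 (Finset.mem_range.1 hk)
  rw [partitionCoeff, Nat.cast_choose ℝ hk']
  have h3 : (k.factorial : ℝ) ≠ 0 := by positivity
  have h4 : ((n - k).factorial : ℝ) ≠ 0 := by positivity
  field_simp

theorem sum_finpartition_card_eq (a : ℕ → ℝ) {α : Type*} [DecidableEq α] :
    ∀ (n : ℕ) (s : Finset α) (m : ℕ), s.card = n →
      (∑ π : Finpartition s with π.parts.card = m, ∏ V ∈ π.parts, a V.card) =
        partitionCoeff a n m := by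
  intro n
  induction n using Nat.strong_induction_on with
  | _ n ih =>
    intro s m hs
    rcases s.eq_empty_or_nonempty with rfl | ⟨x, hxs⟩
    · have hn : n = 0 := by simpa using hs.symm
      subst hn
      have huniq : ∀ π : Finpartition (∅ : Finset α), π.parts = ∅ := fun π =>
        Finpartition.parts_eq_empty_iff.2 rfl
      rw [Finset.sum_filter]
      have hone : (univ : Finset (Finpartition (∅ : Finset α))) =
          {Finpartition.empty (Finset α)} :=
        Finset.eq_singleton_iff_unique_mem.2 ⟨mem_univ _, fun π _ => Finpartition.ext
          ((huniq π).trans (huniq _).symm)⟩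
      rw [hone, Finset.sum_singleton, huniq]
      rcases m with _ | m
      · simp [partitionCoeff]
      · have := coeff_reducedEGF_pow_of_lt a (Nat.succ_pos m) 1
        rw [one_mul] at this
        simp only [Nat.succ_eq_add_one] at this
        simp [partitionCoeff, this]
    · rcases m with _ | m
      · have hn : 0 < n := by rw [← hs]; exact Finset.card_pos.2 ⟨x, hxs⟩
        rw [Finset.filter_false_of_mem, Finset.sum_empty]
        · simp [partitionCoeff, PowerSeries.coeff_one, hn.ne']
        · intro π _ h
          have := π.parts_nonempty (Finset.ne_empty_of_mem hxs)
          rw [Finset.card_eq_zero] at h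
          exact this.ne_empty h
      · obtain ⟨t, hxt, rfl⟩ : ∃ t, x ∉ t ∧ insert x t = s :=
          ⟨s.erase x, Finset.notMem_erase x s, Finset.insert_erase hxs⟩
        rw [Finset.card_insert_of_notMem hxt] at hs
        subst hs
        rw [Finset.sum_filter,
          sum_finpartition_insert hxt fun P => if P.card = m + 1 then ∏ V ∈ P, a V.card else 0,
          partitionCoeff_succ]
        have h := Finset.sum_powerset_apply_card (x := t)
          (fun k => a (k + 1) * partitionCoeff a (t.card - k) m)
        simp only [nsmul_eq_mul] at h
        rw [← h]
        refine Finset.sum_congr rfl fun B hB => ?_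
        have hBt := Finset.mem_powerset.1 hB
        have hxB : x ∉ B := fun h => hxt (hBt h)
        rw [← ih (t.card - B.card) (by omega) (t \ B) m (Finset.card_sdiff_of_subset hBt),
          Finset.mul_sum, Finset.sum_filter]
        refine Finset.sum_congr rfl fun π _ => ?_
        have hnot : insert x B ∉ π.parts := fun h =>
          hxt (Finset.mem_sdiff.1 (π.le h (mem_insert_self x B))).1
        rw [Finset.card_insert_of_notMem hnot, Finset.prod_insert hnot,
          Finset.card_insert_of_notMem hxB]
        simp only [add_left_inj]

/-- The cumulants of a sequence, by Möbius inversion over set partitions. -/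
def cumulantSum (a : ℕ → ℝ) (n : ℕ) : ℝ :=
  ∑ π : SetPartition n, (-1) ^ (π.parts.card - 1) * ((π.parts.card - 1).factorial : ℝ) *
    blockProd a π

/-- A truncation of the formal logarithm of `A`. -/
def truncatedLog (a : ℕ → ℝ) (N : ℕ) : PowerSeries ℝ :=
  ∑ m ∈ range N, PowerSeries.C ((-1) ^ m / ((m : ℝ) + 1)) * reducedEGF a ^ (m + 1)

theorem cumulantSum_eq (a : ℕ → ℝ) {n N : ℕ} (hn : 1 ≤ n) (hN : n ≤ N) :
    cumulantSum a n = (n.factorial : ℝ) * PowerSeries.coeff n (truncatedLog a N) := by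
  have hmem : ∀ π ∈ (univ : Finset (SetPartition n)), π.parts.card - 1 ∈ range N := by
    intro π _
    have := π.card_parts_le_card
    rw [Finset.card_univ, Fintype.card_fin] at this
    rw [Finset.mem_range]
    omega
  rw [cumulantSum, ← Finset.sum_fiberwise_of_maps_to hmem, truncatedLog, map_sum, Finset.mul_sum]
  refine Finset.sum_congr rfl fun m _ => ?_
  have h := sum_finpartition_card_eq a n (univ : Finset (Fin n)) (m + 1) (by simp)
  -- The natural subtraction loses nothing because a partition of a nonempty set has a block.
  have hf : (univ.filter fun π : SetPartition n => π.parts.card - 1 = m) =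
      univ.filter fun π : SetPartition n => π.parts.card = m + 1 := by
    refine Finset.filter_congr fun π _ => ?_
    have : 0 < π.parts.card := Finset.card_pos.2 (π.parts_nonempty
      (Finset.ne_empty_of_mem (mem_univ (⟨0, hn⟩ : Fin n))))
    omega
  have h1 : ∀ π ∈ univ.filter fun π : SetPartition n => π.parts.card = m + 1,
      (-1 : ℝ) ^ (π.parts.card - 1) * ((π.parts.card - 1).factorial : ℝ) * blockProd a π =
      (-1) ^ m * (m.factorial : ℝ) * ∏ V ∈ π.parts, a V.card := by
    intro π hπ
    rw [(Finset.mem_filter.1 hπ).2, Nat.add_sub_cancel]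
    rfl
  rw [hf, Finset.sum_congr rfl h1, ← Finset.mul_sum, h, PowerSeries.coeff_C_mul, partitionCoeff,
    Nat.factorial_succ]
  have h2 : (m.factorial : ℝ) ≠ 0 := by positivity
  have h3 : (m : ℝ) + 1 ≠ 0 := by positivity
  push_cast
  field_simp

/-- This is `A (log A)' = A'` up to an error divisible by `X ^ N`, so a finite truncation suffices
for each coefficient. -/
theorem mul_derivative_truncatedLog (a : ℕ → ℝ) (N : ℕ) :
    (1 + reducedEGF a) * PowerSeries.derivative ℝ (truncatedLog a N) =
      PowerSeries.derivative ℝ (reducedEGF a) -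
        (-1) ^ N * PowerSeries.derivative ℝ (reducedEGF a) * reducedEGF a ^ N := by
  induction N with
  | zero => simp [truncatedLog]
  | succ N ih =>
    have h : truncatedLog a (N + 1) = truncatedLog a N +
        PowerSeries.C ((-1) ^ N / ((N : ℝ) + 1)) * reducedEGF a ^ (N + 1) := by
      rw [truncatedLog, Finset.sum_range_succ]; rfl
    have hd : PowerSeries.derivative ℝ (PowerSeries.C ((-1) ^ N / ((N : ℝ) + 1)) *
        reducedEGF a ^ (N + 1)) = (-1) ^ N * reducedEGF a ^ N *
          PowerSeries.derivative ℝ (reducedEGF a) := by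
      rw [← PowerSeries.smul_eq_C_mul, Derivation.map_smul, PowerSeries.derivative_pow,
        Nat.add_sub_cancel,
        PowerSeries.smul_eq_C_mul,
        show ((N + 1 : ℕ) : PowerSeries ℝ) = PowerSeries.C ((N : ℝ) + 1) by push_cast; simp,
        ← mul_assoc, ← mul_assoc, ← map_mul, div_mul_cancel₀ _ (by positivity)]
      simp
    rw [h, map_add, mul_add, ih, hd]
    ring

/-- Cumulants and moments determine each other by the usual recursion. -/
theorem eq_sum_cumulantSum (a : ℕ → ℝ) (h0 : a 0 = 1) (n : ℕ) :
    a (n + 1) = ∑ k ∈ range (n + 1),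
      (n.choose k : ℝ) * (cumulantSum a (k + 1) * a (n - k)) := by
  have h := congrArg (PowerSeries.coeff n) (mul_derivative_truncatedLog a (n + 1))
  rw [map_sub, coeff_reducedEGF_pow_of_lt a (Nat.lt_succ_self n), sub_zero,
    coeff_derivative_reducedEGF, mul_comm, PowerSeries.coeff_mul,
    Finset.Nat.sum_antidiagonal_eq_sum_range_succ_mk] at h
  have hn : (n.factorial : ℝ) ≠ 0 := by positivity
  rw [eq_div_iff hn] at h
  rw [← h, Finset.sum_mul]
  refine Finset.sum_congr rfl fun k hk => ?_
  have hk' : k ≤ n := Nat.lt_succ_iff.1 (Finset.mem_range.1 hk)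
  rw [PowerSeries.coeff_derivative,
    cumulantSum_eq a (Nat.succ_pos k) (Nat.succ_le_succ hk'),
    Nat.cast_choose ℝ hk', Nat.factorial_succ]
  have hA : PowerSeries.coeff (n - k) (1 + reducedEGF a) =
      a (n - k) / ((n - k).factorial : ℝ) := by
    rw [map_add, PowerSeries.coeff_one, reducedEGF, PowerSeries.coeff_mk]
    split_ifs with h
    · simp [h, h0]
    · simp
  rw [hA]
  have h3 : (k.factorial : ℝ) ≠ 0 := by positivity
  have h4 : ((n - k).factorial : ℝ) ≠ 0 := by positivity
  push_cast
  field_simp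

end SetPartitions

/-! ### Cycle-type counts and the exponential formula for sums over permutations. -/

section Counting

open Equiv Finset

theorem card_partition_parts_eq_mul {α : Type*} [Fintype α] [DecidableEq α] (m : Multiset ℕ)
    (hsum : m.sum = Fintype.card α) (hpos : ∀ k ∈ m, 1 ≤ k) :
    (univ.filter fun σ : Perm α => σ.partition.parts = m).card *
      (m.prod * ∏ k ∈ m.toFinset, (m.count k).factorial) = (Fintype.card α).factorial := by
  -- Mathlib's count is in terms of `cycleType`, which omits fixed points; they are the parts equal
  -- to `1`.
  set m₂ := m.filter (2 ≤ ·) with hm₂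
  have hrest : m.filter (fun k => ¬ 2 ≤ k) = Multiset.replicate (m.count 1) 1 := by
    rw [← Multiset.filter_eq']
    refine Multiset.filter_congr fun k hk => ?_
    have := hpos k hk
    omega
  have hm : m = m₂ + Multiset.replicate (m.count 1) 1 := by
    rw [hm₂, ← hrest, Multiset.filter_add_not]
  have hprod : m.prod = m₂.prod := by
    conv_lhs => rw [hm]
    simp
  have hs : m₂.sum + m.count 1 = Fintype.card α := by
    rw [← hsum]
    conv_rhs => rw [hm]
    simp
  have hfilter : (univ.filter fun σ : Perm α => σ.partition.parts = m) =
      univ.filter fun σ : Perm α => σ.cycleType = m₂ := by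
    refine Finset.filter_congr fun σ _ => ⟨fun h => ?_, fun h => ?_⟩
    · rw [hm₂, ← h, Perm.filter_parts_partition_eq_cycleType]
    · rw [Perm.parts_partition, h, ← Perm.sum_cycleType, h, ← hs, Nat.add_sub_cancel_left]
      exact hm.symm
  have hfact : ∏ k ∈ m.toFinset, (m.count k).factorial =
      (m.count 1).factorial * ∏ k ∈ m₂.toFinset, (m₂.count k).factorial := by
    rw [← Finset.prod_filter_mul_prod_filter_not m.toFinset (2 ≤ ·), mul_comm]
    congr 1
    · rw [← Finset.prod_singleton (fun k => (m.count k).factorial) 1]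
      refine Finset.prod_subset (fun k hk => ?_) fun k hk hk' => ?_
      · rw [Finset.mem_filter, Multiset.mem_toFinset] at hk
        have := hpos k hk.1
        rw [Finset.mem_singleton]
        omega
      · rw [Finset.mem_singleton] at hk
        subst hk
        rw [Finset.mem_filter, Multiset.mem_toFinset, not_and_or] at hk'
        rw [Multiset.count_eq_zero_of_notMem (hk'.resolve_right (by omega)), Nat.factorial_zero]
    · rw [hm₂, Multiset.toFinset_filter]
      refine Finset.prod_congr rfl fun k hk => ?_
      rw [Multiset.count_filter_of_pos (Finset.mem_filter.1 hk).2]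
  have hcard := Perm.card_of_cycleType_mul_eq α m₂
  rw [if_pos ⟨by omega, fun k hk => (Multiset.mem_filter.1 hk).2⟩,
    show Fintype.card α - m₂.sum = m.count 1 by omega] at hcard
  rw [hfilter, hfact, hprod, ← hcard]
  ring

theorem cycleWeight_of_cycleCount_eq_one {n : ℕ} (x : ℕ → ℝ) {σ : Perm (Fin n)}
    (h : cycleCount σ = 1) : cycleWeight x σ = x n := by
  rw [cycleCount, Multiset.card_eq_one] at h
  obtain ⟨k, hk⟩ := h
  have := σ.partition.parts_sum
  rw [hk, Multiset.sum_singleton, Fintype.card_fin] at this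
  rw [cycleWeight, hk, this]
  simp

theorem cycleCount_eq_one_iff {n : ℕ} {σ : Perm (Fin n)} :
    cycleCount σ = 1 ↔ σ.partition.parts = {n} := by
  refine ⟨fun h => ?_, fun h => by rw [cycleCount, h, Multiset.card_singleton]⟩
  rw [cycleCount, Multiset.card_eq_one] at h
  obtain ⟨k, hk⟩ := h
  have := σ.partition.parts_sum
  rw [hk, Multiset.sum_singleton, Fintype.card_fin] at this
  rw [hk, this]

theorem card_cycleCount_eq_one (n : ℕ) :
    (univ.filter fun σ : Perm (Fin (n + 1)) => cycleCount σ = 1).card = n.factorial := by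
  simp only [cycleCount_eq_one_iff]
  have h := card_partition_parts_eq_mul (α := Fin (n + 1)) {n + 1} (by simp) (by simp)
  simp only [Multiset.prod_singleton, Multiset.toFinset_singleton, Finset.prod_singleton,
    Multiset.count_singleton_self, Nat.factorial_one, mul_one, Fintype.card_fin] at h
  rw [Nat.factorial_succ, mul_comm (n + 1)] at h
  exact Nat.eq_of_mul_eq_mul_right (Nat.succ_pos n) h

theorem cycleCount_one (n : ℕ) : cycleCount (1 : Perm (Fin n)) = n := by
  simp [cycleCount, Perm.parts_partition]

theorem jointlyTransitive_of_cycleCount_eq_one {n : ℕ} {σ : Perm (Fin n)} (τ : Perm (Fin n))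
    (h : cycleCount σ = 1) : JointlyTransitive σ τ := by
  rw [cycleCount_eq_card_parts, Finset.card_eq_one] at h
  obtain ⟨V, hV⟩ := h
  refine ⟨fun a b => ?_⟩
  have hp : ∀ a, (cyclePartition σ).part a = V := fun a => by
    rw [← Finset.mem_singleton, ← hV]
    exact (cyclePartition σ).part_mem.2 (mem_univ a)
  have hab : σ.SameCycle a b := by
    rw [← mem_part_cyclePartition, mem_part_comm, hp, hp]
  obtain ⟨k, hk⟩ := hab
  exact ⟨⟨σ ^ k, Subgroup.zpow_mem _ (Subgroup.subset_closure (by simp)) k⟩, hk⟩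

theorem jointlyTransitive_one_iff {n : ℕ} {σ : Perm (Fin (n + 1))} :
    JointlyTransitive σ 1 ↔ cycleCount σ = 1 := by
  refine ⟨fun h => ?_, jointlyTransitive_of_cycleCount_eq_one 1⟩
  have h1 := cycleCount_add_le h
  rw [cycleCount_one, Fintype.card_fin] at h1
  have h2 := cycleCount_pos σ
  omega

/-- The sum of `x_σ` over all permutations of `n` points. -/
def permSum (n : ℕ) (x : ℕ → ℝ) : ℝ := ∑ σ : Perm (Fin n), cycleWeight x σ

theorem totalPairSum_eq_mul (n : ℕ) (x y : ℕ → ℝ) :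
    totalPairSum (Fin n) x y = permSum n x * permSum n y := by
  rw [totalPairSum, permSum, permSum, Finset.sum_mul_sum, Fintype.sum_prod_type]

/-- With this weight the second permutation of a pair is forced to be the identity, so the pair
recursion specialises to one for single permutations, with full cycles as the connected objects. -/
theorem cycleWeight_indicator {n : ℕ} (σ : Perm (Fin n)) :
    cycleWeight (fun j => if j = 1 then 1 else 0) σ = if σ = 1 then 1 else 0 := by
  split_ifs with h
  · subst h
    simp [cycleWeight, Perm.parts_partition]
  · rw [cycleWeight]
    refine Multiset.prod_eq_zero (Multiset.mem_map.2 ?_)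
    obtain ⟨k, hk⟩ := Multiset.exists_mem_of_ne_zero (mt Perm.cycleType_eq_zero.1 h)
    refine ⟨k, ?_, if_neg (Perm.one_lt_of_mem_cycleType hk).ne'⟩
    rw [Perm.parts_partition]
    exact Multiset.mem_add.2 (Or.inl hk)

theorem permSum_indicator (n : ℕ) : permSum n (fun j => if j = 1 then 1 else 0) = 1 := by
  simp [permSum, cycleWeight_indicator]

theorem transitivePairSum_indicator (n : ℕ) (x : ℕ → ℝ) :
    transitivePairSum (Fin (n + 1)) x (fun j => if j = 1 then 1 else 0) =
      (n.factorial : ℝ) * x (n + 1) := by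
  classical
  rw [transitivePairSum, Finset.sum_filter, Fintype.sum_prod_type]
  have h : ∀ σ : Perm (Fin (n + 1)), (∑ τ : Perm (Fin (n + 1)),
      if JointlyTransitive σ τ then
        cycleWeight x σ * cycleWeight (fun j => if j = 1 then 1 else 0) τ else 0) =
      if cycleCount σ = 1 then x (n + 1) else 0 := by
    intro σ
    rw [Finset.sum_eq_single 1]
    · rw [cycleWeight_indicator, if_pos rfl, mul_one]
      by_cases hσ : cycleCount σ = 1
      · rw [if_pos (jointlyTransitive_one_iff.2 hσ), if_pos hσ,
          cycleWeight_of_cycleCount_eq_one x hσ]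
      · rw [if_neg (mt jointlyTransitive_one_iff.1 hσ), if_neg hσ]
    · intro τ _ hτ
      rw [cycleWeight_indicator, if_neg hτ, mul_zero, ite_self]
    · intro h
      exact absurd (mem_univ _) h
  simp only [h]
  rw [← Finset.sum_filter, Finset.sum_const, card_cycleCount_eq_one, nsmul_eq_mul]

theorem permSum_zero (x : ℕ → ℝ) : permSum 0 x = 1 := by
  have := totalPairSum_zero x (fun j => if j = 1 then 1 else 0)
  rwa [totalPairSum_eq_mul, permSum_indicator, mul_one] at this

theorem permSum_succ (n : ℕ) (x : ℕ → ℝ) :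
    permSum (n + 1) x = ∑ k ∈ range (n + 1),
      (n.choose k : ℝ) * ((k.factorial : ℝ) * x (k + 1) * permSum (n - k) x) := by
  have h := totalPairSum_succ n x (fun j => if j = 1 then 1 else 0)
  simp only [totalPairSum_eq_mul, permSum_indicator, mul_one, transitivePairSum_indicator] at h
  exact h

theorem eq_permSum_of_recursion {x : ℕ → ℝ} {f : ℕ → ℝ} (h0 : f 0 = 1)
    (h : ∀ n, f (n + 1) = ∑ k ∈ range (n + 1),
      (n.choose k : ℝ) * ((k.factorial : ℝ) * x (k + 1) * f (n - k))) (n : ℕ) :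
    f n = permSum n x := by
  induction n using Nat.strong_induction_on with
  | _ n ih =>
    rcases n with _ | n
    · rw [h0, permSum_zero]
    · rw [h, permSum_succ]
      refine Finset.sum_congr rfl fun k _ => ?_
      rw [ih (n - k) (by omega)]

/-- This is the expansion of the falling factorial in signed Stirling numbers of the first kind. It
is proved by checking that the falling factorials satisfy the recursion that characterises
`permSum`. -/
theorem permSum_eq_descFactorial (d n : ℕ) :
    permSum n (fun j => (-1) ^ (j - 1) * (d : ℝ)) = (d.descFactorial n : ℝ) := by
  refine (eq_permSum_of_recursion (f := fun n => (d.descFactorial n : ℝ)) (by simp) ?_ n).symm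
  intro n
  simp only [Nat.add_sub_cancel]
  induction n with
  | zero => simp
  | succ n ih =>
    rw [Finset.sum_range_succ']
    have hstep : ∀ k ∈ range (n + 1), (((n + 1).choose (k + 1) : ℕ) : ℝ) *
        (((k + 1).factorial : ℝ) * ((-1) ^ (k + 1) * (d : ℝ)) *
          (d.descFactorial (n + 1 - (k + 1)) : ℝ)) =
        -((n : ℝ) + 1) * ((n.choose k : ℝ) * ((k.factorial : ℝ) * ((-1) ^ k * (d : ℝ)) *
          (d.descFactorial (n - k) : ℝ))) := by
      intro k _
      have h1 : (((n + 1).choose (k + 1) : ℕ) : ℝ) * ((k : ℝ) + 1) =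
          ((n : ℝ) + 1) * (n.choose k : ℝ) := by
        exact_mod_cast (Nat.add_one_mul_choose_eq n k).symm
      rw [Nat.factorial_succ, Nat.add_sub_add_right, pow_succ]
      push_cast
      linear_combination (-1 : ℝ) * (k.factorial : ℝ) * (-1) ^ k * (d : ℝ) *
        (d.descFactorial (n - k) : ℝ) * h1
    rw [Finset.sum_congr rfl hstep, ← Finset.mul_sum, ← ih, Nat.descFactorial_succ d (n + 1)]
    simp only [Nat.choose_zero_right, Nat.factorial_zero, pow_zero, Nat.sub_zero, Nat.cast_one,
      one_mul]
    -- For `d < n + 1` the difference `d - (n + 1)` is truncated, but the falling factorial it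
    -- multiplies is zero.
    rcases le_or_gt (n + 1) d with hd | hd
    · rw [Nat.cast_mul, Nat.cast_sub hd]
      push_cast
      ring
    · rw [Nat.descFactorial_eq_zero_iff_lt.2 hd]
      simp

end Counting

/-! ### The exact moment formula in terms of finite free cumulants. -/

section ExactFormula

open Equiv Finset

theorem cycleWeight_mul {α : Type*} [Fintype α] [DecidableEq α] (u v : ℕ → ℝ) (σ : Perm α) :
    cycleWeight (fun j => u j * v j) σ = cycleWeight u σ * cycleWeight v σ := by
  simp only [cycleWeight_eq_prod, Finset.prod_mul_distrib]

theorem cycleWeight_pow_pred {α : Type*} [Fintype α] [DecidableEq α] (c : ℝ) (σ : Perm α) :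
    cycleWeight (fun j => c ^ (j - 1)) σ = c ^ (Fintype.card α - cycleCount σ) := by
  rw [cycleWeight_eq_prod, Finset.prod_pow_eq_pow_sum, cycleCount_eq_card_parts]
  congr 1
  have h := (cyclePartition σ).sum_card_parts
  rw [Finset.card_univ] at h
  rw [← h, Finset.sum_tsub_distrib, Finset.sum_const, smul_eq_mul, mul_one]
  intro V hV
  exact Finset.card_pos.2 ((cyclePartition σ).nonempty_of_mem_parts hV)

theorem cycleWeight_const {α : Type*} [Fintype α] [DecidableEq α] (c : ℝ) (σ : Perm α) :
    cycleWeight (fun _ => c) σ = c ^ cycleCount σ := by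
  rw [cycleWeight_eq_prod, Finset.prod_const, cycleCount_eq_card_parts]

/-- Newton's identities for a multiset of real numbers. -/
theorem newton_multiset (s : Multiset ℝ) (n : ℕ) :
    ((n : ℝ) + 1) * s.esymm (n + 1) = ∑ k ∈ range (n + 1),
      (-1) ^ k * s.esymm (n - k) * (s.map fun x => x ^ (k + 1)).sum := by
  obtain ⟨l, rfl⟩ := Quot.exists_rep s
  -- Indexing the multiset by `Fin l.length` allows the polynomial Newton identity to be evaluated
  -- at its entries.
  have hl : (Quot.mk _ l : Multiset ℝ) = (univ : Finset (Fin l.length)).val.map l.get := by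
    simp only [Fin.univ_val_map, List.ofFn_get]
    rfl
  rw [hl]
  have h := congrArg (MvPolynomial.aeval (R := ℝ) l.get)
    (MvPolynomial.mul_esymm_eq_sum (Fin l.length) ℝ (n + 1))
  rw [map_mul, map_mul, map_sum] at h
  simp only [map_mul, map_pow, map_neg, map_one, map_natCast, MvPolynomial.psum, map_sum,
    MvPolynomial.aeval_X, MvPolynomial.aeval_esymm_eq_multiset_esymm] at h
  rw [Finset.sum_filter, Finset.Nat.sum_antidiagonal_eq_sum_range_succ_mk,
    Finset.sum_range_succ] at h
  simp only [lt_self_iff_false, if_false, add_zero] at h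
  push_cast at h
  rw [h, ← Finset.sum_range_reflect, Finset.mul_sum]
  refine Finset.sum_congr rfl fun k hk => ?_
  have hk' : k ≤ n := Nat.lt_succ_iff.1 (Finset.mem_range.1 hk)
  rw [if_pos (by omega), Multiset.map_map, show n + 1 - 1 - k = n - k by omega,
    show n + 1 - (n - k) = k + 1 by omega]
  change _ * (_ * ∑ i, l.get i ^ (k + 1)) = _ * ∑ i, l.get i ^ (k + 1)
  have hsign : ((-1 : ℝ)) ^ (n + 1 + 1) * (-1) ^ (n - k) = (-1) ^ k := by
    rw [← pow_add, show n + 1 + 1 + (n - k) = k + 2 * (n - k + 1) by omega, pow_add, pow_mul]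
    simp
  linear_combination (Multiset.esymm (Multiset.map l.get univ.val) (n - k)) *
    (∑ i, l.get i ^ (k + 1)) * hsign

/-- The weight of a cycle of length `j` coming from the coefficients. -/
def coeffWeight (p : Polynomial ℝ) (j : ℕ) : ℝ :=
  cumulantSum (normCoeff p) j / ((j - 1).factorial : ℝ)

theorem normCoeff_zero {p : Polynomial ℝ} (hp : p.Monic) : normCoeff p 0 = 1 := by
  simp [normCoeff, hp.coeff_natDegree]

theorem normCoeff_eq_permSum {p : Polynomial ℝ} (hp : p.Monic) (n : ℕ) :
    normCoeff p n = permSum n (coeffWeight p) := by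
  refine eq_permSum_of_recursion (normCoeff_zero hp) (fun n => ?_) n
  rw [eq_sum_cumulantSum _ (normCoeff_zero hp)]
  refine Finset.sum_congr rfl fun k _ => ?_
  rw [coeffWeight, Nat.add_sub_cancel, mul_div_cancel₀]
  positivity

/-- The binomial coefficient dividing out in `a_n` is restored by the falling factorial: the first
weight contributes `a_n`, the second `n!` times that binomial coefficient. -/
theorem totalPairSum_eq_esymm {d : ℕ} {p : Polynomial ℝ} (hp : IsMonicRealRooted d p) {n : ℕ}
    (hn : n ≤ d) :
    totalPairSum (Fin n) (coeffWeight p) (fun j => (-1) ^ (j - 1) * (d : ℝ)) =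
      (n.factorial : ℝ) * p.roots.esymm n := by
  obtain ⟨hmonic, hdeg, hsplit⟩ := hp
  rw [totalPairSum_eq_mul, permSum_eq_descFactorial, ← normCoeff_eq_permSum hmonic, normCoeff,
    Polynomial.coeff_eq_esymm_roots_of_splits hsplit (Nat.sub_le _ _), hdeg, hmonic.leadingCoeff,
    Nat.sub_sub_self hn, Nat.descFactorial_eq_factorial_mul_choose]
  have h0 : (d.choose n : ℝ) ≠ 0 := by exact_mod_cast (Nat.choose_pos hn).ne'
  have h1 : ((-1 : ℝ) ^ n) * (-1) ^ n = 1 := by rw [← mul_pow]; simp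
  push_cast
  field_simp
  linear_combination p.roots.esymm n * h1

/-- The orbit recursion and Newton's identities express the same quantities `n! e_n` by convolutions
of the same shape. By induction all terms except the last agree, so the last ones do. -/
theorem transitivePairSum_eq_power_sum {d : ℕ} {p : Polynomial ℝ} (hp : IsMonicRealRooted d p) :
    ∀ n, n + 1 ≤ d →
      transitivePairSum (Fin (n + 1)) (coeffWeight p) (fun j => (-1) ^ (j - 1) * (d : ℝ)) =
        (n.factorial : ℝ) * (-1) ^ n * (p.roots.map fun x => x ^ (n + 1)).sum := by
  intro n
  induction n using Nat.strong_induction_on with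
  | _ n ih =>
    intro hn
    have h1 := totalPairSum_succ n (coeffWeight p) (fun j => (-1) ^ (j - 1) * (d : ℝ))
    rw [totalPairSum_eq_esymm hp hn] at h1
    have h2 := newton_multiset p.roots n
    have h3 : ((n + 1).factorial : ℝ) * p.roots.esymm (n + 1) = ∑ k ∈ range (n + 1),
        (n.choose k : ℝ) * ((k.factorial : ℝ) * (-1) ^ k *
          (p.roots.map fun x => x ^ (k + 1)).sum *
          totalPairSum (Fin (n - k)) (coeffWeight p) (fun j => (-1) ^ (j - 1) * (d : ℝ))) := by
      rw [Nat.factorial_succ]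
      push_cast
      rw [show ((n : ℝ) + 1) * (n.factorial : ℝ) * p.roots.esymm (n + 1) =
        (n.factorial : ℝ) * (((n : ℝ) + 1) * p.roots.esymm (n + 1)) by ring, h2, Finset.mul_sum]
      refine Finset.sum_congr rfl fun k hk => ?_
      have hk' : k ≤ n := Nat.lt_succ_iff.1 (Finset.mem_range.1 hk)
      rw [totalPairSum_eq_esymm hp (by omega), Nat.cast_choose ℝ hk']
      have h3 : (k.factorial : ℝ) ≠ 0 := by positivity
      have h4 : ((n - k).factorial : ℝ) ≠ 0 := by positivity
      field_simp
    rw [h3, Finset.sum_range_succ, Finset.sum_range_succ] at h1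
    have h4 : ∀ k ∈ range n, (n.choose k : ℝ) * (transitivePairSum (Fin (k + 1)) (coeffWeight p)
        (fun j => (-1) ^ (j - 1) * (d : ℝ)) * totalPairSum (Fin (n - k)) (coeffWeight p)
          (fun j => (-1) ^ (j - 1) * (d : ℝ))) =
        (n.choose k : ℝ) * ((k.factorial : ℝ) * (-1) ^ k *
          (p.roots.map fun x => x ^ (k + 1)).sum *
          totalPairSum (Fin (n - k)) (coeffWeight p) (fun j => (-1) ^ (j - 1) * (d : ℝ))) := by
      intro k hk
      have hk' := Finset.mem_range.1 hk
      rw [ih k hk' (by omega)]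
    rw [Finset.sum_congr rfl h4, add_right_inj, Nat.sub_self, totalPairSum_zero, Nat.choose_self]
      at h1
    simpa using h1.symm

open Classical in
/-- The polynomial in `u` and `ε` that expresses moments through finite free cumulants. -/
def genusExpansion (n : ℕ) (u : ℕ → ℝ) (ε : ℝ) : ℝ :=
  1 / (n.factorial : ℝ) * ∑ p : Perm (Fin (n + 1)) × Perm (Fin (n + 1)) with
    JointlyTransitive p.1 p.2,
      cycleWeight u p.1 * (-ε) ^ (n + 2 - (cycleCount p.1 + cycleCount p.2))

theorem coeffWeight_eq {d : ℕ} (hd : 1 ≤ d) {p : Polynomial ℝ} (hp : p.natDegree = d) (j : ℕ) :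
    coeffWeight p j = finiteFreeCumulant p j * (-(1 / (d : ℝ))) ^ (j - 1) := by
  have hd0 : (d : ℝ) ≠ 0 := by positivity
  have h1 : (-(d : ℝ)) ^ (j - 1) * (-(1 / (d : ℝ))) ^ (j - 1) = 1 := by
    rw [← mul_pow]
    simp [hd0]
  rw [coeffWeight, finiteFreeCumulant, hp, ← cumulantSum]
  linear_combination (-(cumulantSum (normCoeff p) j / ((j - 1).factorial : ℝ))) * h1

/-- The exact expression of the moments of a polynomial through its finite free cumulants. -/
theorem rootMoment_eq_genusExpansion {d : ℕ} {p : Polynomial ℝ} (hp : IsMonicRealRooted d p)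
    {n : ℕ} (hn : n + 1 ≤ d) :
    rootMoment p (n + 1) = genusExpansion n (finiteFreeCumulant p) (1 / (d : ℝ)) := by
  classical
  have hd0 : (d : ℝ) ≠ 0 := by
    have : 0 < d := by omega
    positivity
  have h := transitivePairSum_eq_power_sum hp n hn
  have hn0 : (n.factorial : ℝ) ≠ 0 := by positivity
  have hsq : ((-1 : ℝ) ^ n) * (-1) ^ n = 1 := by rw [← mul_pow]; simp
  have h1 : rootMoment p (n + 1) = 1 / (n.factorial : ℝ) * ((-1) ^ n * (1 / (d : ℝ)) *
      transitivePairSum (Fin (n + 1)) (coeffWeight p) (fun j => (-1) ^ (j - 1) * (d : ℝ))) := by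
    rw [h, rootMoment, hp.2.1]
    field_simp
    linear_combination (-(Multiset.map (fun x => x ^ (n + 1)) p.roots).sum) * hsq
  rw [h1, genusExpansion, transitivePairSum, Finset.mul_sum]
  congr 1
  refine Finset.sum_congr rfl fun q hq => ?_
  have htrans : JointlyTransitive q.1 q.2 := (Finset.mem_filter.1 hq).2
  have hle := cycleCount_add_le htrans
  rw [Fintype.card_fin] at hle
  have hx : cycleWeight (coeffWeight p) q.1 = cycleWeight (finiteFreeCumulant p) q.1 *
      (-(1 / (d : ℝ))) ^ (n + 1 - cycleCount q.1) := by
    rw [show coeffWeight p = fun j => finiteFreeCumulant p j * (-(1 / (d : ℝ))) ^ (j - 1) from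
      funext (coeffWeight_eq (by omega) hp.2.1), cycleWeight_mul, cycleWeight_pow_pred,
      Fintype.card_fin]
  have hy : cycleWeight (fun j => (-1) ^ (j - 1) * (d : ℝ)) q.2 =
      (-1) ^ (n + 1 - cycleCount q.2) * (d : ℝ) ^ cycleCount q.2 := by
    rw [cycleWeight_mul, cycleWeight_pow_pred, cycleWeight_const, Fintype.card_fin]
  rw [hx, hy]
  have h2 := cycleCount_pos q.1
  have h3 := cycleCount_pos q.2
  generalize cycleCount q.1 = s at *
  generalize cycleCount q.2 = t at *
  have hpow : (-1 : ℝ) ^ n * (1 / (d : ℝ)) * ((-(1 / (d : ℝ))) ^ (n + 1 - s) *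
      ((-1) ^ (n + 1 - t) * (d : ℝ) ^ t)) = (-(1 / (d : ℝ))) ^ (n + 2 - (s + t)) := by
    obtain ⟨r, hr⟩ := Nat.exists_eq_add_of_le hle
    -- This uses `t ≥ 1` and `s + t ≤ n + 2`. The `t - 1` split-off factors and the prefactor `1/d`
    -- cancel `d ^ t`.
    have e1 : n + 1 - s = (n + 2 - (s + t)) + (t - 1) := by omega
    have hs : (-1 : ℝ) ^ n * (-1) ^ (t - 1) * (-1) ^ (n + 1 - t) = 1 := by
      rw [← pow_add, ← pow_add, show n + (t - 1) + (n + 1 - t) = 2 * n by omega, pow_mul]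
      simp
    have hd' : (1 / (d : ℝ)) ^ (t - 1) * (1 / (d : ℝ)) * (d : ℝ) ^ t = 1 := by
      rw [← pow_succ, Nat.sub_add_cancel h3, ← mul_pow, one_div_mul_cancel hd0, one_pow]
    rw [e1, pow_add]
    generalize (-(1 / (d : ℝ))) ^ (n + 2 - (s + t)) = z
    rw [show (-(1 / (d : ℝ))) ^ (t - 1) = (-1) ^ (t - 1) * (1 / (d : ℝ)) ^ (t - 1) by
      rw [← mul_pow, neg_one_mul]]
    linear_combination z * ((-1 : ℝ) ^ n * (-1) ^ (t - 1) * (-1) ^ (n + 1 - t)) * hd' + z * hs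
  linear_combination cycleWeight (finiteFreeCumulant p) q.1 * hpow

end ExactFormula

/-! ### The two leading coefficients of the genus expansion. -/

section GenusExpansion

open Equiv Finset

open Classical in
/-- The sum of `u_σ` over the permutations `σ` that act transitively together with `γ` and satisfy
`|σ| + |σ⁻¹ γ| = c`. -/
def relativeSum {N : ℕ} (u : ℕ → ℝ) (c : ℕ) (γ : Perm (Fin N)) : ℝ :=
  ∑ σ : Perm (Fin N) with
    JointlyTransitive σ γ ∧ cycleCount σ + cycleCount (σ⁻¹ * γ) = c, cycleWeight u σ

theorem jointlyTransitive_mul_iff {α : Type*} {σ τ : Perm α} :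
    JointlyTransitive σ (σ * τ) ↔ JointlyTransitive σ τ := by
  have h : Subgroup.closure {σ, σ * τ} = Subgroup.closure {σ, τ} := by
    have hs : ∀ ρ : Perm α, σ ∈ Subgroup.closure {σ, ρ} ∧ ρ ∈ Subgroup.closure {σ, ρ} :=
      fun ρ => ⟨Subgroup.subset_closure (by simp), Subgroup.subset_closure (by simp)⟩
    apply le_antisymm
    · rw [Subgroup.closure_le]
      rintro x (rfl | rfl)
      · exact (hs τ).1
      · exact Subgroup.mul_mem _ (hs τ).1 (hs τ).2
    · rw [Subgroup.closure_le]
      rintro x (rfl | rfl)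
      · exact (hs (x * τ)).1
      · have := Subgroup.mul_mem _ (Subgroup.inv_mem _ (hs (σ * x)).1) (hs (σ * x)).2
        rwa [inv_mul_cancel_left] at this
  rw [JointlyTransitive, JointlyTransitive, h]

open Classical in
-- The substitution `γ = σ τ` preserves the generated group and turns `τ` into `σ⁻¹ γ`.
theorem sum_pairs_eq_sum_relativeSum (N : ℕ) (u : ℕ → ℝ) (c : ℕ) :
    (∑ p : Perm (Fin N) × Perm (Fin N) with
      JointlyTransitive p.1 p.2 ∧ cycleCount p.1 + cycleCount p.2 = c, cycleWeight u p.1) =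
      ∑ γ : Perm (Fin N), relativeSum u c γ := by
  simp only [relativeSum, Finset.sum_filter]
  rw [Fintype.sum_prod_type, Finset.sum_comm (γ := Perm (Fin N)) (s := univ) (t := univ)
    (f := fun γ σ => if JointlyTransitive σ γ ∧ cycleCount σ + cycleCount (σ⁻¹ * γ) = c
      then cycleWeight u σ else 0)]
  refine Finset.sum_congr rfl fun σ _ => ?_
  rw [← Equiv.sum_comp (Equiv.mulLeft σ) fun γ =>
    if JointlyTransitive σ γ ∧ cycleCount σ + cycleCount (σ⁻¹ * γ) = c
      then cycleWeight u σ else 0]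
  refine Finset.sum_congr rfl fun τ _ => ?_
  simp only [Equiv.coe_mulLeft, inv_mul_cancel_left, jointlyTransitive_mul_iff]

theorem JointlyTransitive.conj {α : Type*} {σ τ : Perm α} (h : JointlyTransitive σ τ)
    (g : Perm α) : JointlyTransitive (g * σ * g⁻¹) (g * τ * g⁻¹) := by
  refine ⟨fun a b => ?_⟩
  obtain ⟨⟨k, hk⟩, hkab⟩ := h.exists_smul_eq (g⁻¹ a) (g⁻¹ b)
  have key := (exists_mem_closure_of_agree (g : α → α) (σ := σ) (τ := τ) (σ' := g * σ * g⁻¹)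
    (τ' := g * τ * g⁻¹) (fun c => by simp) (fun c => by simp)).1 k hk
  obtain ⟨k', hk', h'⟩ := key
  refine ⟨⟨k', hk'⟩, ?_⟩
  change k' a = b
  have h1 := h' (g⁻¹ a)
  have h2 : k (g⁻¹ a) = g⁻¹ b := hkab
  rw [h2] at h1
  simpa using h1.symm

theorem relativeSum_conj {N : ℕ} (u : ℕ → ℝ) (c : ℕ) (g γ : Perm (Fin N)) :
    relativeSum u c (g * γ * g⁻¹) = relativeSum u c γ := by
  classical
  symm
  refine Finset.sum_equiv (MulAut.conj g).toEquiv (fun σ => ?_) fun σ _ => ?_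
  · simp only [mem_filter, mem_univ, true_and, MulEquiv.toEquiv_eq_coe, EquivLike.coe_coe,
      MulAut.conj_apply]
    have h1 : (g * σ * g⁻¹)⁻¹ * (g * γ * g⁻¹) = g * (σ⁻¹ * γ) * g⁻¹ := by group
    rw [h1, cycleCount_conj, cycleCount_conj]
    refine and_congr ⟨fun h => h.conj g, fun h => ?_⟩ Iff.rfl
    have := h.conj g⁻¹
    rwa [show g⁻¹ * (g * σ * g⁻¹) * g⁻¹⁻¹ = σ by group,
      show g⁻¹ * (g * γ * g⁻¹) * g⁻¹⁻¹ = γ by group] at this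
  · exact (cycleWeight_conj u g σ).symm

/-- Permutations of equal cycle type are conjugate, so `γ` may be replaced by a standard rotation or
annular rotation. -/
theorem relativeSum_congr {N : ℕ} (u : ℕ → ℝ) (c : ℕ) {γ γ' : Perm (Fin N)}
    (h : γ.partition.parts = γ'.partition.parts) : relativeSum u c γ = relativeSum u c γ' := by
  obtain ⟨g, rfl⟩ := isConj_iff.1 (Perm.partition_eq_of_isConj.2 (Nat.Partition.ext h))
  exact (relativeSum_conj u c g γ).symm

theorem relativeSum_eq_zero {n c : ℕ} (u : ℕ → ℝ) {γ : Perm (Fin (n + 1))}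
    (h : ∀ σ τ : Perm (Fin (n + 1)), JointlyTransitive σ τ →
      cycleCount σ + cycleCount τ = c → σ * τ ≠ γ) : relativeSum u c γ = 0 := by
  classical
  rw [relativeSum, Finset.filter_false_of_mem, Finset.sum_empty]
  rintro σ - ⟨h1, h2⟩
  refine h σ (σ⁻¹ * γ) ?_ h2 (mul_inv_cancel_left _ _)
  rw [← jointlyTransitive_mul_iff, mul_inv_cancel_left]
  exact h1

/-- The leading coefficient of the genus expansion is the sum over non-crossing partitions. -/
theorem sum_relativeSum_genus_zero (n : ℕ) (u : ℕ → ℝ) :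
    ∑ γ : Perm (Fin (n + 1)), relativeSum u (n + 2) γ =
      (n.factorial : ℝ) * ∑ π ∈ NC (n + 1), blockProd u π := by
  classical
  rw [← Finset.sum_filter_of_ne (p := fun γ => cycleCount γ = 1)]
  · have h : ∀ γ ∈ univ.filter fun γ : Perm (Fin (n + 1)) => cycleCount γ = 1,
        relativeSum u (n + 2) γ = ∑ π ∈ NC (n + 1), blockProd u π := by
      intro γ hγ
      rw [relativeSum_congr u _ ((cycleCount_eq_one_iff.1 (Finset.mem_filter.1 hγ).2).trans
        (cycleCount_eq_one_iff.1 (cycleCount_finRotate n)).symm), ← sum_genus_zero_eq_sum_NC]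
      refine Finset.sum_congr (Finset.filter_congr fun σ _ => ?_) fun _ _ => rfl
      refine and_iff_right ?_
      have := jointlyTransitive_of_mul_eq_finRotate
        (mul_inv_cancel_left σ (finRotate (n + 1)))
      rwa [← jointlyTransitive_mul_iff, mul_inv_cancel_left] at this
    rw [Finset.sum_congr rfl h, Finset.sum_const, card_cycleCount_eq_one, nsmul_eq_mul]
  · intro γ _ hne
    by_contra hγ
    refine hne (relativeSum_eq_zero u fun σ τ h hc hστ => hγ ?_)
    rw [← hστ]
    exact cycleCount_mul_eq_one h (by rw [Fintype.card_fin]; exact hc)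

theorem partition_parts_sumCongr {α β : Type*} [Fintype α] [DecidableEq α] [Fintype β]
    [DecidableEq β] (σ : Perm α) (τ : Perm β) :
    (Perm.sumCongr σ τ).partition.parts = σ.partition.parts + τ.partition.parts := by
  classical
  let p : α ⊕ β → Prop := fun x => x.isLeft = true
  let eL : α ≃ {x : α ⊕ β // p x} :=
    ⟨fun a => ⟨Sum.inl a, rfl⟩, fun x => x.1.getLeft x.2, fun _ => rfl, fun x => by simp⟩
  let eR : β ≃ {x : α ⊕ β // ¬p x} :=
    ⟨fun b => ⟨Sum.inr b, by simp [p]⟩, fun x => x.1.getRight (by simpa [p] using x.2),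
      fun _ => rfl, fun x => by simp⟩
  have h : Perm.sumCongr σ τ = Perm.subtypeCongr (eL.permCongr σ) (eR.permCongr τ) := by
    ext x
    rcases x with a | b
    · rw [Perm.subtypeCongr.left_apply _ _ (show p (Sum.inl a) from rfl)]
      rfl
    · rw [Perm.subtypeCongr.right_apply _ _ (show ¬p (Sum.inr b) by simp [p])]
      rfl
  rw [h, partition_parts_subtypeCongr, partition_parts_permCongr, partition_parts_permCongr]

theorem partition_parts_annularRotation {t s : ℕ} (ht : 1 ≤ t) (hs : 1 ≤ s) :
    (annularRotation t s).partition.parts = {t, s} := by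
  obtain ⟨t, rfl⟩ := Nat.exists_eq_add_of_le' ht
  obtain ⟨s, rfl⟩ := Nat.exists_eq_add_of_le' hs
  rw [annularRotation, partition_parts_permCongr, partition_parts_sumCongr,
    cycleCount_eq_one_iff.1 (cycleCount_finRotate t),
    cycleCount_eq_one_iff.1 (cycleCount_finRotate s)]
  rfl

theorem relativeSum_eq_sum_annularNC {N t s : ℕ} (u : ℕ → ℝ) (hN : t + s = N) (ht : 1 ≤ t)
    (hs : 1 ≤ s) {γ : Perm (Fin N)} (hγ : γ.partition.parts = {t, s}) :
    relativeSum u N γ = ∑ σ ∈ annularNC t s, cycleProd u σ := by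
  classical
  subst hN
  rw [relativeSum_congr u _ (hγ.trans (partition_parts_annularRotation ht hs).symm), relativeSum,
    annularNC]
  refine Finset.sum_congr ?_ fun _ _ => rfl
  ext σ
  simp only [mem_filter, mem_univ, true_and]
  exact Iff.rfl

/-- Ordered pairs of cycle lengths meet each `γ` twice, except that equal lengths give a single
pair, counted with weight `2`. The same weight compensates the symmetry factor in
`card_two_cycles_mul`, and the total `2` is the source of the `1/2` in the annular term. -/
theorem sum_two_cycles_multiplicity {N : ℕ} {γ : Perm (Fin N)} (hγ : cycleCount γ = 2) :
    (∑ ts ∈ (antidiagonal N).filter (fun ts => 1 ≤ ts.1 ∧ 1 ≤ ts.2),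
      if γ.partition.parts = {ts.1, ts.2} then (if ts.1 = ts.2 then (2 : ℝ) else 1) else 0) = 2 := by
  rw [cycleCount, Multiset.card_eq_two] at hγ
  obtain ⟨a, b, hab⟩ := hγ
  have hsum : a + b = N := by
    have := γ.partition.parts_sum
    rw [hab, Fintype.card_fin] at this
    simpa using this
  have ha : 1 ≤ a := γ.partition.parts_pos (by rw [hab]; simp)
  have hb : 1 ≤ b := γ.partition.parts_pos (by rw [hab]; simp)
  rw [← Finset.sum_filter]
  have hset : ((antidiagonal N).filter (fun ts : ℕ × ℕ => 1 ≤ ts.1 ∧ 1 ≤ ts.2)).filter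
      (fun ts => γ.partition.parts = {ts.1, ts.2}) = {(a, b), (b, a)} := by
    ext ⟨t, s⟩
    simp only [mem_filter, HasAntidiagonal.mem_antidiagonal, mem_insert, mem_singleton, Prod.mk.injEq, hab]
    have hpair : ({a, b} : Multiset ℕ) = {t, s} ↔ (t = a ∧ s = b) ∨ (t = b ∧ s = a) := by
      constructor
      · intro h
        have h1 : a ∈ ({t, s} : Multiset ℕ) := by rw [← h]; simp
        have h2 : t ∈ ({a, b} : Multiset ℕ) := by rw [h]; simp
        have h3 := congrArg Multiset.sum h
        simp at h1 h2 h3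
        omega
      · rintro (⟨rfl, rfl⟩ | ⟨rfl, rfl⟩)
        · rfl
        · exact Multiset.pair_comm _ _
    rw [hpair]
    constructor
    · exact fun h => h.2
    · intro h
      refine ⟨⟨?_, ?_⟩, h⟩ <;> omega
  rw [hset]
  by_cases h : a = b
  · subst h
    simp
  · have : (a, b) ≠ (b, a) := fun h' => h (Prod.ext_iff.1 h').1
    rw [Finset.sum_pair this, if_neg h, if_neg (Ne.symm h)]
    norm_num

theorem card_two_cycles_mul {N t s : ℕ} (hN : t + s = N) (ht : 1 ≤ t) (hs : 1 ≤ s) :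
    ((univ.filter fun γ : Perm (Fin N) => γ.partition.parts = {t, s}).card : ℝ) *
      (if t = s then (2 : ℝ) else 1) = (N.factorial : ℝ) / ((t : ℝ) * (s : ℝ)) := by
  have h := (card_partition_parts_eq_mul (α := Fin N) {t, s} (by simpa using hN)
    (by simp [ht, hs])).trans (congrArg Nat.factorial (Fintype.card_fin N))
  have ht0 : (t : ℝ) ≠ 0 := by positivity
  have hs0 : (s : ℝ) ≠ 0 := by positivity
  rw [eq_div_iff (mul_ne_zero ht0 hs0)]
  have hmult : (∏ k ∈ ({t, s} : Multiset ℕ).toFinset, (({t, s} : Multiset ℕ).count k).factorial) =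
      if t = s then 2 else 1 := by
    split_ifs with hts
    · subst hts
      simp
    · have : ({t, s} : Multiset ℕ).toFinset = {t, s} := by ext; simp
      rw [this, Finset.prod_pair hts]
      simp [hts, Ne.symm hts]
  rw [hmult, show ({t, s} : Multiset ℕ).prod = t * s by simp] at h
  rw [← h]
  split_ifs <;> push_cast <;> ring

/-- The second coefficient of the genus expansion is the sum over annular non-crossing
permutations. -/
theorem sum_relativeSum_annular (n : ℕ) (u : ℕ → ℝ) :
    ∑ γ : Perm (Fin (n + 1)), relativeSum u (n + 1) γ =
      ((n + 1).factorial : ℝ) / 2 *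
        ∑ ts ∈ (antidiagonal (n + 1)).filter (fun ts => 1 ≤ ts.1 ∧ 1 ≤ ts.2),
          ∑ σ ∈ annularNC ts.1 ts.2, cycleProd u σ / ((ts.1 : ℝ) * (ts.2 : ℝ)) := by
  classical
  rw [← Finset.sum_filter_of_ne (p := fun γ => cycleCount γ = 2)]
  · have h1 : ∀ γ ∈ univ.filter fun γ : Perm (Fin (n + 1)) => cycleCount γ = 2,
        relativeSum u (n + 1) γ = 1 / 2 *
          ∑ ts ∈ (antidiagonal (n + 1)).filter (fun ts => 1 ≤ ts.1 ∧ 1 ≤ ts.2),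
            if γ.partition.parts = {ts.1, ts.2} then
              (if ts.1 = ts.2 then (2 : ℝ) else 1) * relativeSum u (n + 1) γ else 0 := by
      intro γ hγ
      have := sum_two_cycles_multiplicity (Finset.mem_filter.1 hγ).2
      rw [show (∑ ts ∈ (antidiagonal (n + 1)).filter (fun ts => 1 ≤ ts.1 ∧ 1 ≤ ts.2),
          if γ.partition.parts = {ts.1, ts.2} then
            (if ts.1 = ts.2 then (2 : ℝ) else 1) * relativeSum u (n + 1) γ else 0) =
          2 * relativeSum u (n + 1) γ by
        have h2 := congrArg (· * relativeSum u (n + 1) γ) this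
        simp only [Finset.sum_mul] at h2
        rw [← h2]
        exact Finset.sum_congr rfl fun ts _ => by split_ifs <;> ring]
      ring
    have h2 : ∀ ts ∈ (antidiagonal (n + 1)).filter (fun ts : ℕ × ℕ => 1 ≤ ts.1 ∧ 1 ≤ ts.2),
        (∑ γ ∈ univ.filter fun γ : Perm (Fin (n + 1)) => cycleCount γ = 2,
          if γ.partition.parts = {ts.1, ts.2} then
            (if ts.1 = ts.2 then (2 : ℝ) else 1) * relativeSum u (n + 1) γ else 0) =
        ((n + 1).factorial : ℝ) *
          ∑ σ ∈ annularNC ts.1 ts.2, cycleProd u σ / ((ts.1 : ℝ) * (ts.2 : ℝ)) := by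
      intro ts hts
      obtain ⟨hN, ht, hs⟩ := Finset.mem_filter.1 hts
      rw [HasAntidiagonal.mem_antidiagonal] at hN
      rw [← Finset.sum_filter, Finset.filter_filter]
      have hset : (univ.filter fun γ : Perm (Fin (n + 1)) =>
          cycleCount γ = 2 ∧ γ.partition.parts = {ts.1, ts.2}) =
          univ.filter fun γ : Perm (Fin (n + 1)) => γ.partition.parts = {ts.1, ts.2} := by
        refine Finset.filter_congr fun γ _ => and_iff_right_of_imp fun h => ?_
        rw [cycleCount, h]
        rfl
      rw [hset, Finset.sum_congr rfl fun γ hγ => by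
        rw [relativeSum_eq_sum_annularNC u hN ht hs (Finset.mem_filter.1 hγ).2],
        Finset.sum_const, nsmul_eq_mul, ← mul_assoc, card_two_cycles_mul hN ht hs,
        ← Finset.sum_div]
      ring
    rw [Finset.sum_congr rfl h1, ← Finset.mul_sum, Finset.sum_comm, Finset.sum_congr rfl h2,
      ← Finset.mul_sum]
    ring
  -- A product with any other number of cycles contributes nothing, by the genus inequality and
  -- parity.
  · intro γ _ hne
    by_contra hγ
    refine hne (relativeSum_eq_zero u fun σ τ h hc hστ => hγ ?_)
    rw [← hστ]
    exact cycleCount_mul_eq_two h (by rw [Fintype.card_fin]; exact hc)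

end GenusExpansion

/-! ### First-order expansions in `1/d`, and the genus expansion under them. -/

section Expansions

/-- `f d = a + b / d + o(1/d)`, phrased as a limit. -/
def HasExpansion (f : ℕ → ℝ) (a b : ℝ) : Prop :=
  Tendsto (fun d : ℕ => (d : ℝ) * (f d - a)) atTop (𝓝 b)

theorem isLittleO_iff_hasExpansion {f : ℕ → ℝ} {a b : ℝ} :
    (fun d : ℕ => f d - (a + 1 / (d : ℝ) * b)) =o[atTop] (fun d : ℕ => 1 / (d : ℝ)) ↔
      HasExpansion f a b := by
  have hne : ∀ᶠ d : ℕ in atTop, (d : ℝ) ≠ 0 := by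
    filter_upwards [eventually_ge_atTop 1] with d hd
    positivity
  rw [isLittleO_iff_tendsto' (by
    filter_upwards [hne] with d hd h
    exact absurd h (one_div_ne_zero hd)), HasExpansion]
  refine Iff.trans (tendsto_congr' ?_) tendsto_sub_nhds_zero_iff
  filter_upwards [hne] with d hd
  field_simp
  ring

namespace HasExpansion

variable {f g : ℕ → ℝ} {a b a' b' : ℝ}

theorem tendsto (h : HasExpansion f a b) : Tendsto f atTop (𝓝 a) := by
  have h1 : Tendsto (fun d : ℕ => (d : ℝ) * (f d - a) * (1 / (d : ℝ)) + a) atTop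
      (𝓝 (b * 0 + a)) :=
    (Tendsto.mul h tendsto_one_div_atTop_nhds_zero_nat).add_const a
  rw [mul_zero, zero_add] at h1
  refine h1.congr' ?_
  filter_upwards [eventually_ge_atTop 1] with d hd
  have : (d : ℝ) ≠ 0 := by positivity
  field_simp
  ring

theorem unique (h : HasExpansion f a b) (h' : HasExpansion f a' b') : a = a' ∧ b = b' := by
  obtain rfl := tendsto_nhds_unique h.tendsto h'.tendsto
  exact ⟨rfl, tendsto_nhds_unique h h'⟩

theorem congr' (h : HasExpansion f a b) (hfg : f =ᶠ[atTop] g) : HasExpansion g a b := by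
  refine Tendsto.congr' ?_ h
  filter_upwards [hfg] with d hd
  rw [hd]

theorem const (a : ℝ) : HasExpansion (fun _ => a) a 0 := by
  simp [HasExpansion]

theorem one_div : HasExpansion (fun d => 1 / (d : ℝ)) 0 1 := by
  refine Tendsto.congr' ?_ tendsto_const_nhds
  filter_upwards [eventually_ge_atTop 1] with d hd
  have : (d : ℝ) ≠ 0 := by positivity
  field_simp
  simp

theorem add (h : HasExpansion f a b) (h' : HasExpansion g a' b') :
    HasExpansion (fun d => f d + g d) (a + a') (b + b') := by
  refine (Tendsto.add h h').congr fun d => ?_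
  ring

theorem mul (h : HasExpansion f a b) (h' : HasExpansion g a' b') :
    HasExpansion (fun d => f d * g d) (a * a') (b * a' + a * b') := by
  refine ((Tendsto.mul h h'.tendsto).add (Tendsto.const_mul a h')).congr fun d => ?_
  ring

theorem const_mul (h : HasExpansion f a b) (c : ℝ) :
    HasExpansion (fun d => c * f d) (c * a) (c * b) := by
  simpa using (const c).mul h

theorem inv (h : HasExpansion f a b) (ha : a ≠ 0) :
    HasExpansion (fun d => (f d)⁻¹) a⁻¹ (-b / (a * a)) := by
  refine Tendsto.congr' ?_ ((Tendsto.neg h).div (h.tendsto.mul_const a) (mul_ne_zero ha ha))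
  filter_upwards [h.tendsto.eventually_ne ha] with d hd
  simp only [Pi.div_apply]
  field_simp
  ring

theorem sum {ι : Type*} (s : Finset ι) {f : ι → ℕ → ℝ} {a b : ι → ℝ}
    (h : ∀ i ∈ s, HasExpansion (f i) (a i) (b i)) :
    HasExpansion (fun d => ∑ i ∈ s, f i d) (∑ i ∈ s, a i) (∑ i ∈ s, b i) := by
  refine (tendsto_finsetSum s h).congr fun d => ?_
  rw [← Finset.mul_sum, Finset.sum_sub_distrib]

theorem prod {ι : Type*} [DecidableEq ι] (s : Finset ι) {f : ι → ℕ → ℝ} {a b : ι → ℝ}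
    (h : ∀ i ∈ s, HasExpansion (f i) (a i) (b i)) :
    HasExpansion (fun d => ∏ i ∈ s, f i d) (∏ i ∈ s, a i)
      (∑ i ∈ s, b i * ∏ j ∈ s.erase i, a j) := by
  induction s using Finset.induction_on with
  | empty => simpa using const 1
  | insert x s hx ih =>
    have h1 := (h x (Finset.mem_insert_self x s)).mul
      (ih fun i hi => h i (Finset.mem_insert_of_mem hi))
    have h2 : (∑ i ∈ insert x s, b i * ∏ j ∈ (insert x s).erase i, a j) =
        b x * ∏ j ∈ s, a j + a x * ∑ i ∈ s, b i * ∏ j ∈ s.erase i, a j := by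
      rw [Finset.sum_insert hx, Finset.erase_insert hx, Finset.mul_sum]
      congr 1
      refine Finset.sum_congr rfl fun i hi => ?_
      have hix : x ≠ i := fun h => hx (h ▸ hi)
      rw [Finset.erase_insert_of_ne hix, Finset.prod_insert
        (fun h => hx (Finset.mem_of_mem_erase h))]
      ring
    rw [h2, Finset.prod_insert hx]
    simpa only [Finset.prod_insert hx] using h1

theorem exists_pow (h : HasExpansion f a b) (k : ℕ) :
    ∃ b', HasExpansion (fun d => f d ^ k) (a ^ k) b' := by
  induction k with
  | zero => exact ⟨0, by simpa using const 1⟩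
  | succ k ih =>
    obtain ⟨b', hb'⟩ := ih
    exact ⟨_, by simpa only [pow_succ] using hb'.mul h⟩

end HasExpansion

open Equiv Finset

theorem hasExpansion_neg_one_div_pow (k : ℕ) :
    ∃ b, HasExpansion (fun d => (-(1 / (d : ℝ))) ^ k) (0 ^ k) b := by
  have h := HasExpansion.one_div.const_mul (-1)
  simp only [neg_one_mul, neg_zero] at h
  exact h.exists_pow k

theorem hasExpansion_cycleWeight {N : ℕ} {f : ℕ → ℕ → ℝ} {a b : ℕ → ℝ} (σ : Perm (Fin N))
    (h : ∀ V ∈ (cyclePartition σ).parts, HasExpansion (f V.card) (a V.card) (b V.card)) :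
    ∃ b', HasExpansion (fun d => cycleWeight (fun j => f j d) σ) (cycleWeight a σ) b' := by
  simp only [cycleWeight_eq_prod]
  exact ⟨_, HasExpansion.prod (cyclePartition σ).parts (f := fun V => f V.card) h⟩

open Classical in
/-- The part of the genus expansion of order at least two. -/
def genusRemainder (n : ℕ) (u : ℕ → ℝ) (ε : ℝ) : ℝ :=
  1 / (n.factorial : ℝ) * ∑ p : Perm (Fin (n + 1)) × Perm (Fin (n + 1)) with
    JointlyTransitive p.1 p.2 ∧ cycleCount p.1 + cycleCount p.2 ≤ n,
      cycleWeight u p.1 * (-ε) ^ (n - (cycleCount p.1 + cycleCount p.2))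

/-- The annular sum of the second term of the genus expansion. -/
def annularSum (u : ℕ → ℝ) (n : ℕ) : ℝ :=
  ∑ ts ∈ (antidiagonal n).filter (fun ts => 1 ≤ ts.1 ∧ 1 ≤ ts.2),
    ∑ σ ∈ annularNC ts.1 ts.2, cycleProd u σ / ((ts.1 : ℝ) * (ts.2 : ℝ))

/-- The pairs are sorted by `|σ| + |τ|` being `n + 2`, `n + 1` or at most `n`. In the annular term
`1/n!` against `(n+1)!/2` leaves `(n+1)/2`. -/
theorem genusExpansion_eq (n : ℕ) (u : ℕ → ℝ) (ε : ℝ) :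
    genusExpansion n u ε = ∑ π ∈ NC (n + 1), blockProd u π +
      (-1) * (ε * ((((n + 1 : ℕ) : ℝ) / 2) * annularSum u (n + 1))) +
      ε * (ε * genusRemainder n u ε) := by
  classical
  have hn0 : (n.factorial : ℝ) ≠ 0 := by positivity
  have h0 := sum_relativeSum_genus_zero n u
  have h1 := sum_relativeSum_annular n u
  rw [← sum_pairs_eq_sum_relativeSum] at h0 h1
  have hsplit : ∀ p : Perm (Fin (n + 1)) × Perm (Fin (n + 1)),
      (if JointlyTransitive p.1 p.2 then
        cycleWeight u p.1 * (-ε) ^ (n + 2 - (cycleCount p.1 + cycleCount p.2)) else 0) =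
      (if JointlyTransitive p.1 p.2 ∧ cycleCount p.1 + cycleCount p.2 = n + 2 then
        cycleWeight u p.1 else 0) +
      (-ε) * (if JointlyTransitive p.1 p.2 ∧ cycleCount p.1 + cycleCount p.2 = n + 1 then
        cycleWeight u p.1 else 0) +
      ε * (ε * (if JointlyTransitive p.1 p.2 ∧ cycleCount p.1 + cycleCount p.2 ≤ n then
        cycleWeight u p.1 * (-ε) ^ (n - (cycleCount p.1 + cycleCount p.2)) else 0)) := by
    intro p
    by_cases hp : JointlyTransitive p.1 p.2
    · have hle := cycleCount_add_le hp
      rw [Fintype.card_fin] at hle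
      simp only [hp, true_and, if_true]
      generalize cycleCount p.1 + cycleCount p.2 = c at *
      rcases Nat.lt_or_ge n c with hc | hc
      · rcases Nat.lt_or_ge (n + 1) c with hc' | hc'
        · have : c = n + 2 := by omega
          subst this
          simp
        · have : c = n + 1 := by omega
          subst this
          simp [show n + 2 - (n + 1) = 1 by omega]
          ring
      · rw [if_neg (by omega), if_neg (by omega), if_pos hc,
          show n + 2 - c = (n - c) + 2 by omega, pow_add]
        ring
    · simp [hp]
  rw [genusExpansion, Finset.sum_filter, Finset.sum_congr rfl fun p _ => hsplit p,
    Finset.sum_add_distrib, Finset.sum_add_distrib, ← Finset.mul_sum, ← Finset.mul_sum,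
    ← Finset.mul_sum, ← Finset.sum_filter, ← Finset.sum_filter, ← Finset.sum_filter, h0, h1,
    genusRemainder, annularSum, Nat.factorial_succ]
  push_cast
  field_simp

/-- The Leibniz rule on the non-crossing sum gives the marked-block term. The annular sum already
has a factor `1/d`, so only its limit counts, and the remainder has `1/d^2` and disappears. -/
theorem hasExpansion_genusExpansion (n : ℕ) {f : ℕ → ℕ → ℝ} {a b : ℕ → ℝ}
    (h : ∀ j, 1 ≤ j → j ≤ n + 1 → HasExpansion (f j) (a j) (b j)) :
    HasExpansion (fun d => genusExpansion n (fun j => f j d) (1 / (d : ℝ)))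
      (∑ π ∈ NC (n + 1), blockProd a π) (infinitesimalMomentFormula a b (n + 1)) := by
  classical
  -- The free `N` is needed because annular permutations act on `Fin (t + s)`, equal to `Fin (n +
  -- 1)` only propositionally.
  have hw : ∀ (N : ℕ) (_ : N = n + 1) (σ : Perm (Fin N)), ∃ b',
      HasExpansion (fun d => cycleWeight (fun j => f j d) σ) (cycleWeight a σ) b' := by
    intro N hN σ
    refine hasExpansion_cycleWeight (b := b) σ fun V hV => h _ ?_ ?_
    · exact Finset.card_pos.2 ((cyclePartition σ).nonempty_of_mem_parts hV)
    · have := Finset.card_le_univ V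
      rw [Fintype.card_fin] at this
      omega
  have hNC : HasExpansion (fun d => ∑ π ∈ NC (n + 1), blockProd (fun j => f j d) π)
      (∑ π ∈ NC (n + 1), blockProd a π)
      (∑ π ∈ NC (n + 1), ∑ V ∈ π.parts, (b V.card * ∏ W ∈ π.parts.erase V, a W.card)) := by
    refine HasExpansion.sum _ fun π _ => ?_
    refine HasExpansion.prod π.parts (f := fun V => f V.card) (a := fun V => a V.card)
      (b := fun V => b V.card) fun V hV => h _ ?_ ?_
    · exact Finset.card_pos.2 (π.nonempty_of_mem_parts hV)
    · have := Finset.card_le_univ V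
      rwa [Fintype.card_fin] at this
  have hann : ∃ b', HasExpansion (fun d => annularSum (fun j => f j d) (n + 1))
      (annularSum a (n + 1)) b' := by
    have hts : ∀ ts ∈ (antidiagonal (n + 1)).filter (fun ts : ℕ × ℕ => 1 ≤ ts.1 ∧ 1 ≤ ts.2),
        ∃ b', HasExpansion (fun d => ∑ σ ∈ annularNC ts.1 ts.2,
          cycleProd (fun j => f j d) σ / ((ts.1 : ℝ) * (ts.2 : ℝ)))
          (∑ σ ∈ annularNC ts.1 ts.2, cycleProd a σ / ((ts.1 : ℝ) * (ts.2 : ℝ))) b' := by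
      intro ts hts
      have hN := HasAntidiagonal.mem_antidiagonal.1 (Finset.mem_filter.1 hts).1
      choose c hc using hw _ hN
      refine ⟨_, HasExpansion.sum _ (b := fun σ => ((ts.1 : ℝ) * (ts.2 : ℝ))⁻¹ * c σ)
        fun σ _ => ?_⟩
      have := (hc σ).const_mul ((ts.1 : ℝ) * (ts.2 : ℝ))⁻¹
      simp only [div_eq_inv_mul]
      exact this
    choose! c hc using hts
    exact ⟨_, HasExpansion.sum _ hc⟩
  have hrem : ∃ a' b', HasExpansion
      (fun d => genusRemainder n (fun j => f j d) (1 / (d : ℝ))) a' b' := by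
    choose c hc using hw _ rfl
    choose e he using hasExpansion_neg_one_div_pow
    exact ⟨_, _, (HasExpansion.sum _ fun p _ => (hc p.1).mul (he _)).const_mul _⟩
  obtain ⟨c, hc⟩ := hann
  obtain ⟨a', b', hr⟩ := hrem
  have hfinal := (hNC.add ((HasExpansion.one_div.mul
    (hc.const_mul (((n + 1 : ℕ) : ℝ) / 2))).const_mul (-1))).add
    (HasExpansion.one_div.mul (HasExpansion.one_div.mul hr))
  simp only [genusExpansion_eq]
  convert! hfinal using 1
  · ring
  · rw [infinitesimalMomentFormula, annularSum]
    ring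

open Classical in
/-- The part of the genus expansion that only involves `u_1, …, u_n`. -/
def genusLower (n : ℕ) (u : ℕ → ℝ) (ε : ℝ) : ℝ :=
  1 / (n.factorial : ℝ) * ∑ p : Perm (Fin (n + 1)) × Perm (Fin (n + 1)) with
    JointlyTransitive p.1 p.2 ∧ cycleCount p.1 ≠ 1,
      cycleWeight u p.1 * (-ε) ^ (n + 2 - (cycleCount p.1 + cycleCount p.2))

/-- The coefficient of `u_{n+1}` in the genus expansion. -/
def genusTop (n : ℕ) (ε : ℝ) : ℝ :=
  ∑ τ : Perm (Fin (n + 1)), (-ε) ^ (n + 1 - cycleCount τ)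

/-- The variable `u (n + 1)` occurs only when `σ` is a full cycle; then every `τ` gives a transitive
pair, and the `n!` full cycles cancel the prefactor. This is the form that can be solved for the top
cumulant. -/
theorem genusExpansion_eq_top_add_lower (n : ℕ) (u : ℕ → ℝ) (ε : ℝ) :
    genusExpansion n u ε = u (n + 1) * genusTop n ε + genusLower n u ε := by
  classical
  have hn0 : (n.factorial : ℝ) ≠ 0 := by positivity
  have h1 : ∀ p : Perm (Fin (n + 1)) × Perm (Fin (n + 1)),
      (if JointlyTransitive p.1 p.2 then
        cycleWeight u p.1 * (-ε) ^ (n + 2 - (cycleCount p.1 + cycleCount p.2)) else 0) =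
      (if cycleCount p.1 = 1 then u (n + 1) * (-ε) ^ (n + 1 - cycleCount p.2) else 0) +
      (if JointlyTransitive p.1 p.2 ∧ cycleCount p.1 ≠ 1 then
        cycleWeight u p.1 * (-ε) ^ (n + 2 - (cycleCount p.1 + cycleCount p.2)) else 0) := by
    intro p
    by_cases hc : cycleCount p.1 = 1
    · simp only [jointlyTransitive_of_cycleCount_eq_one p.2 hc, hc, if_true, ne_eq,
        not_true_eq_false, and_false, if_false, add_zero, cycleWeight_of_cycleCount_eq_one u hc]
      congr 2
      omega
    · simp [hc]
  have h2 : (∑ p : Perm (Fin (n + 1)) × Perm (Fin (n + 1)),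
      if cycleCount p.1 = 1 then u (n + 1) * (-ε) ^ (n + 1 - cycleCount p.2) else 0) =
      (n.factorial : ℝ) * (u (n + 1) * genusTop n ε) := by
    rw [Fintype.sum_prod_type]
    have : ∀ σ : Perm (Fin (n + 1)), (∑ τ : Perm (Fin (n + 1)),
        if cycleCount σ = 1 then u (n + 1) * (-ε) ^ (n + 1 - cycleCount τ) else 0) =
        if cycleCount σ = 1 then u (n + 1) * genusTop n ε else 0 := by
      intro σ
      split_ifs
      · rw [genusTop, Finset.mul_sum]
      · simp
    rw [Finset.sum_congr rfl fun σ _ => this σ, ← Finset.sum_filter, Finset.sum_const,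
      card_cycleCount_eq_one, nsmul_eq_mul]
  rw [genusExpansion, Finset.sum_filter, Finset.sum_congr rfl fun p _ => h1 p,
    Finset.sum_add_distrib, h2, ← Finset.sum_filter, genusLower]
  field_simp

theorem cycleCount_eq_card_iff {α : Type*} [Fintype α] [DecidableEq α] {σ : Perm α} :
    cycleCount σ = Fintype.card α ↔ σ = 1 := by
  constructor
  · intro h
    rw [cycleCount, Perm.parts_partition, Multiset.card_add, Multiset.card_replicate] at h
    have h1 : σ.support.card ≤ Fintype.card α := Finset.card_le_univ _
    have h2 := Multiset.card_nsmul_le_sum (s := σ.cycleType) (a := 2)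
      fun k hk => Perm.two_le_of_mem_cycleType hk
    rw [Perm.sum_cycleType, smul_eq_mul] at h2
    exact Perm.card_cycleType_eq_zero.1 (by omega)
  · rintro rfl
    simp [cycleCount, Perm.parts_partition]

/-- The exponent vanishes only for the identity, so the limit is `1` and the coefficient is
eventually invertible. -/
theorem hasExpansion_genusTop (n : ℕ) :
    ∃ b, HasExpansion (fun d => genusTop n (1 / (d : ℝ))) 1 b := by
  choose e he using hasExpansion_neg_one_div_pow
  have h := HasExpansion.sum univ fun (τ : Perm (Fin (n + 1))) _ => he (n + 1 - cycleCount τ)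
  have h1 : (∑ τ : Perm (Fin (n + 1)), (0 : ℝ) ^ (n + 1 - cycleCount τ)) = 1 := by
    rw [Finset.sum_eq_single 1]
    · rw [cycleCount_one, Nat.sub_self, pow_zero]
    · intro τ _ hτ
      refine zero_pow ?_
      have h1 := mt cycleCount_eq_card_iff.1 hτ
      have h2 := cycleCount_le τ
      rw [Fintype.card_fin] at h1 h2
      omega
    · intro h
      exact absurd (mem_univ _) h
  rw [h1] at h
  exact ⟨_, h⟩

theorem hasExpansion_genusLower (n : ℕ) {f : ℕ → ℕ → ℝ} {a b : ℕ → ℝ}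
    (h : ∀ j, 1 ≤ j → j ≤ n → HasExpansion (f j) (a j) (b j)) :
    ∃ a' b', HasExpansion (fun d => genusLower n (fun j => f j d) (1 / (d : ℝ))) a' b' := by
  classical
  have hw : ∀ σ : Perm (Fin (n + 1)), cycleCount σ ≠ 1 → ∃ b',
      HasExpansion (fun d => cycleWeight (fun j => f j d) σ) (cycleWeight a σ) b' := by
    intro σ hσ
    refine hasExpansion_cycleWeight (b := b) σ fun V hV => h _ ?_ ?_
    · exact Finset.card_pos.2 ((cyclePartition σ).nonempty_of_mem_parts hV)
    · have h1 := Finset.card_le_univ V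
      rw [Fintype.card_fin] at h1
      -- A cycle of length `n + 1` would be the only one, so excluding full cycles leaves only
      -- cumulants of order at most `n`.
      by_contra hlt
      have hVu : V = univ := (Finset.card_eq_iff_eq_univ V).1 (by rw [Fintype.card_fin]; omega)
      refine hσ ?_
      rw [cycleCount_eq_card_parts, Finset.card_eq_one]
      refine ⟨V, Finset.eq_singleton_iff_unique_mem.2 ⟨hV, fun W hW => ?_⟩⟩
      obtain ⟨x, hx⟩ := (cyclePartition σ).nonempty_of_mem_parts hW
      exact (cyclePartition σ).eq_of_mem_parts hW hV hx (by rw [hVu]; exact mem_univ x)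
  choose! c hc using hw
  choose e he using hasExpansion_neg_one_div_pow
  exact ⟨_, _, (HasExpansion.sum _ fun p hp =>
    (hc p.1 (Finset.mem_filter.1 hp).2.2).mul (he _)).const_mul _⟩

theorem parts_top_eq (n : ℕ) : (⊤ : SetPartition (n + 1)).parts = {univ} :=
  (Finset.Nonempty.subset_singleton_iff
    (Finpartition.parts_nonempty _ (Finset.ne_empty_of_mem (mem_univ 0)))).1
    (Finpartition.parts_top_subset _)

theorem sum_NC_eq_add (n : ℕ) (F : SetPartition (n + 1) → ℝ) :
    ∑ π ∈ NC (n + 1), F π = F ⊤ + ∑ π ∈ (NC (n + 1)).erase ⊤, F π :=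
  (Finset.add_sum_erase _ _ top_mem_NC).symm

theorem eq_of_sum_NC_eq {n : ℕ} {u v : ℕ → ℝ} (hlow : ∀ j, j ≤ n → u j = v j)
    (h : ∑ π ∈ NC (n + 1), blockProd u π = ∑ π ∈ NC (n + 1), blockProd v π) :
    u (n + 1) = v (n + 1) := by
  have htop : ∀ u : ℕ → ℝ, blockProd u (⊤ : SetPartition (n + 1)) = u (n + 1) := by
    intro u
    simp [blockProd, parts_top_eq]
  have hrest : ∑ π ∈ (NC (n + 1)).erase ⊤, blockProd u π =
      ∑ π ∈ (NC (n + 1)).erase ⊤, blockProd v π := by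
    refine Finset.sum_congr rfl fun π hπ => Finset.prod_congr rfl fun V hV => hlow _ ?_
    exact Nat.lt_succ_iff.1 (card_lt_of_ne_top (Finset.ne_of_mem_erase hπ) hV)
  rw [sum_NC_eq_add, sum_NC_eq_add, htop, htop, hrest] at h
  exact add_right_cancel h

/-- The one-block partition contributes `u n` itself; all other terms involve shorter blocks or do
not depend on `u`. -/
theorem eq_of_infinitesimalMomentFormula_eq {r u v : ℕ → ℝ}
    (h : ∀ n, 1 ≤ n → infinitesimalMomentFormula r u n = infinitesimalMomentFormula r v n)
    (n : ℕ) (hn : 1 ≤ n) : u n = v n := by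
  induction n using Nat.strong_induction_on with
  | _ n ih =>
    obtain ⟨n, rfl⟩ := Nat.exists_eq_add_of_le' hn
    have h1 := h (n + 1) hn
    rw [infinitesimalMomentFormula, infinitesimalMomentFormula, sub_left_inj, sum_NC_eq_add,
      sum_NC_eq_add, parts_top_eq] at h1
    have hrest : ∑ π ∈ (NC (n + 1)).erase ⊤,
        ∑ V ∈ π.parts, (u V.card * ∏ W ∈ π.parts.erase V, r W.card) =
        ∑ π ∈ (NC (n + 1)).erase ⊤,
          ∑ V ∈ π.parts, (v V.card * ∏ W ∈ π.parts.erase V, r W.card) := by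
      refine Finset.sum_congr rfl fun π hπ => Finset.sum_congr rfl fun V hV => ?_
      rw [ih V.card (card_lt_of_ne_top (Finset.ne_of_mem_erase hπ) hV)
        (Finset.card_pos.2 (π.nonempty_of_mem_parts hV))]
    rw [hrest] at h1
    simpa using h1

end Expansions

/-! ### Transfer of expansions between moments and cumulants. -/

section Main

theorem hasInfinitesimalMoments_iff {p : ℕ → Polynomial ℝ} {μ : Measure ℝ} {m' : ℕ → ℝ} :
    HasInfinitesimalMoments p μ m' ↔
      ∀ n, 1 ≤ n → HasExpansion (fun d => rootMoment (p d) n) (moment μ n) (m' n) :=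
  forall₂_congr fun _ _ => isLittleO_iff_hasExpansion

theorem hasCumulantFluctuations_iff {p : ℕ → Polynomial ℝ} {μ : Measure ℝ} {rhat : ℕ → ℝ} :
    HasCumulantFluctuations p μ rhat ↔
      ∀ n, 1 ≤ n → HasExpansion (fun d => finiteFreeCumulant (p d) n) (freeCumulant μ n)
        (rhat n) :=
  forall₂_congr fun _ _ => isLittleO_iff_hasExpansion

variable {p : ℕ → Polynomial ℝ} {μ : Measure ℝ}

theorem rootMoment_eventuallyEq (hp : ∀ d : ℕ, 1 ≤ d → IsMonicRealRooted d (p d)) (n : ℕ) :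
    (fun d => rootMoment (p d) (n + 1)) =ᶠ[atTop]
      fun d => genusExpansion n (fun j => finiteFreeCumulant (p d) j) (1 / (d : ℝ)) := by
  filter_upwards [eventually_ge_atTop (n + 1)] with d hd
  exact rootMoment_eq_genusExpansion (hp d (by omega)) hd

theorem HasCumulantFluctuations.hasInfinitesimalMoments
    (hp : ∀ d : ℕ, 1 ≤ d → IsMonicRealRooted d (p d)) {rhat : ℕ → ℝ}
    (h : HasCumulantFluctuations p μ rhat) :
    HasInfinitesimalMoments p μ (infinitesimalMomentFormula (freeCumulant μ) rhat) := by
  rw [hasCumulantFluctuations_iff] at h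
  rw [hasInfinitesimalMoments_iff]
  intro n hn
  obtain ⟨n, rfl⟩ := Nat.exists_eq_add_of_le' hn
  have h1 := hasExpansion_genusExpansion n (f := fun j d => finiteFreeCumulant (p d) j)
    fun j hj _ => h j hj
  rw [moment_eq_sum_blockProd (moment μ) hn]
  exact h1.congr' (rootMoment_eventuallyEq hp n).symm

theorem HasInfinitesimalMoments.exists_expansion
    (hp : ∀ d : ℕ, 1 ≤ d → IsMonicRealRooted d (p d)) {m' : ℕ → ℝ}
    (h : HasInfinitesimalMoments p μ m') (n : ℕ) (hn : 1 ≤ n) :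
    ∃ b, HasExpansion (fun d => finiteFreeCumulant (p d) n) (freeCumulant μ n) b := by
  rw [hasInfinitesimalMoments_iff] at h
  induction n using Nat.strong_induction_on with
  | _ n ih =>
    obtain ⟨n, rfl⟩ := Nat.exists_eq_add_of_le' hn
    choose! b hb using ih
    have hm := (h (n + 1) hn).congr' (rootMoment_eventuallyEq hp n)
    obtain ⟨a', b', hlow⟩ := hasExpansion_genusLower n
      (f := fun j d => finiteFreeCumulant (p d) j) fun j hj hjn => hb j (by omega) hj
    obtain ⟨q, hq⟩ := hasExpansion_genusTop n
    -- Solving the affine relation gives the top cumulant as moment minus lower part, divided by a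
    -- quantity tending to `1`.
    obtain ⟨x, y, hxy⟩ : ∃ x y,
        HasExpansion (fun d => finiteFreeCumulant (p d) (n + 1)) x y := by
      refine ⟨_, _, ((hm.add (hlow.const_mul (-1))).mul (hq.inv one_ne_zero)).congr' ?_⟩
      filter_upwards [hq.tendsto.eventually_ne one_ne_zero] with d hd
      rw [genusExpansion_eq_top_add_lower]
      field_simp
      ring
    -- The limit `x` is not yet identified. The forward expansion with `x` in place of the free
    -- cumulant of order `n + 1`, compared with the known moment limit, yields a moment-cumulant
    -- equation that forces `x` to be that cumulant.
    have hall := hasExpansion_genusExpansion n (f := fun j d => finiteFreeCumulant (p d) j)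
      (a := Function.update (freeCumulant μ) (n + 1) x) (b := Function.update b (n + 1) y) (by
        intro j hj hjn
        by_cases hjn' : j = n + 1
        · subst hjn'
          simpa using hxy
        · rw [Function.update_of_ne hjn', Function.update_of_ne hjn']
          exact hb j (by omega) hj)
    have hlead := (hall.unique hm).1
    rw [moment_eq_sum_blockProd (moment μ) hn] at hlead
    have hx := eq_of_sum_NC_eq (v := freeCumulantSeq (moment μ))
      (fun j hj => Function.update_of_ne (by omega) _ _) hlead
    rw [Function.update_self] at hx
    exact ⟨y, by rw [show freeCumulant μ (n + 1) = x from hx.symm]; exact hxy⟩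

end Main

end

end FiniteFree

/-! ### The equivalence and the relation between the two sequences. -/

theorem mainTheorem4 (p : ℕ → Polynomial ℝ)
    (hp : ∀ d : ℕ, 1 ≤ d → FiniteFree.IsMonicRealRooted d (p d))
    (μ : MeasureTheory.Measure ℝ) [MeasureTheory.IsProbabilityMeasure μ]
    (hμ : FiniteFree.HasLimitingDistribution p μ) :
    ((∃ m' : ℕ → ℝ, FiniteFree.HasInfinitesimalMoments p μ m') ↔
      (∃ rhat : ℕ → ℝ, FiniteFree.HasCumulantFluctuations p μ rhat)) ∧
    (∀ m' rhat : ℕ → ℝ,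
      FiniteFree.HasInfinitesimalMoments p μ m' →
      FiniteFree.HasCumulantFluctuations p μ rhat →
      ∀ n : ℕ, 1 ≤ n →
        m' n = FiniteFree.infinitesimalMomentFormula (FiniteFree.freeCumulant μ) rhat n) ∧
    (∀ m' rhat : ℕ → ℝ,
      (∀ n : ℕ, 1 ≤ n →
        m' n = FiniteFree.infinitesimalMomentFormula (FiniteFree.freeCumulant μ) rhat n) →
      (FiniteFree.HasInfinitesimalMoments p μ m' ↔
        FiniteFree.HasCumulantFluctuations p μ rhat)) := by
  have hback : ∀ m' : ℕ → ℝ, FiniteFree.HasInfinitesimalMoments p μ m' →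
      ∃ rhat : ℕ → ℝ, FiniteFree.HasCumulantFluctuations p μ rhat := by
    intro m' h
    choose! b hb using h.exists_expansion hp
    exact ⟨b, FiniteFree.hasCumulantFluctuations_iff.2 hb⟩
  have hrel : ∀ m' rhat : ℕ → ℝ, FiniteFree.HasInfinitesimalMoments p μ m' →
      FiniteFree.HasCumulantFluctuations p μ rhat → ∀ n : ℕ, 1 ≤ n →
        m' n = FiniteFree.infinitesimalMomentFormula (FiniteFree.freeCumulant μ) rhat n := by
    intro m' rhat hm hr n hn
    exact ((FiniteFree.hasInfinitesimalMoments_iff.1 hm n hn).unique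
      (FiniteFree.hasInfinitesimalMoments_iff.1 (hr.hasInfinitesimalMoments hp) n hn)).2
  refine ⟨⟨fun ⟨m', h⟩ => hback m' h, fun ⟨rhat, h⟩ => ⟨_, h.hasInfinitesimalMoments hp⟩⟩,
    hrel, fun m' rhat hstar => ⟨fun hm => ?_, fun hr => ?_⟩⟩
  -- The true fluctuation sequence `rhat₀` also satisfies `(*)` with `m'`, and `(*)` determines it
  -- uniquely, so it agrees with `rhat` for `n ≥ 1`.
  · obtain ⟨rhat₀, h₀⟩ := hback m' hm
    have heq := FiniteFree.eq_of_infinitesimalMomentFormula_eq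
      (r := FiniteFree.freeCumulant μ) (u := rhat₀) (v := rhat) fun n hn => by
        rw [← hrel m' rhat₀ hm h₀ n hn, hstar n hn]
    rw [FiniteFree.hasCumulantFluctuations_iff] at h₀ ⊢
    intro n hn
    rw [← heq n hn]
    exact h₀ n hn
  · have h := hr.hasInfinitesimalMoments hp
    rw [FiniteFree.hasInfinitesimalMoments_iff] at h ⊢
    intro n hn
    rw [hstar n hn]
    exact h n hn
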